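/- Let $E,A\in\mathbb R^{n\times n}$, $B\in\mathbb R^{n\times m}$, $C\in\mathbb R^{m\times n}$, $D\in\mathbb R^{m\times m}$ be the matrices of the descriptor system $E\dot x=Ax+Bu$, $y=Cx+Du$ (with as many outputs as inputs). Assume that the pencil $\lambda E-A$ is regular, i.e. $\det(\lambda E-A)\neq0$ for some $\lambda\in\mathbb C$, and that the system is R-controllable and R-observable, i.e. $\operatorname{rank}[\lambda E-A,\ B]=n$ and $\operatorname{rank}\begin{bmatrix}\lambda E-A\\ C\end{bmatrix}=n$ for all $\lambda\in\mathbb C$. Let $\varsigma>0$ and let $G(s)=C(sE-A)^{-1}B+D$ be the transfer function. By the Weierstrass form there are invertible matrices $W,T$ with $$W(\lambda E-A)T=\lambda\begin{bmatrix}I&0\\0&N\end{bmatrix}-\begin{bmatrix}J&0\\0&I\end{bmatrix},\qquad N\text{ nilpotent};$$ let $P_\ell=W^{-1}\begin{bmatrix}I&0\\0&0\end{bmatrix}W$ and $P_r=T\begin{bmatrix}I&0\\0&0\end{bmatrix}T^{-1}$ be the spectral projectors onto the left and right deflating subspaces of the finite eigenvalues (they are real and do not depend on the choice of $W,T$). Write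 $G=G_{sp}+P$ with $G_{sp}$ strictly proper rational and $P(s)=\sum_{k\ge0}M_ks^k$ polynomial. Then $G(s)G^T(-s)=\varsigma^2I_m$ (for all $s\in\mathbb C$ such that neither $s$ nor $-s$ is a finite eigenvalue of $\lambda E-A$) if and only if there are matrices $\mathcal G_{pc},\mathcal G_{po}\in\mathbb R^{n\times n}$ such that all of the following hold: 1. $\mathcal G_{pc}$ and $\mathcal G_{po}$ are symmetric, $\mathcal G_{pc}=P_r\mathcal G_{pc}P_r^T$ and $\mathcal G_{po}=P_\ell^T\mathcal G_{po}P_\ell$; 2. $E\mathcal G_{pc}A^T+A\mathcal G_{pc}E^T+P_\ell BB^TP_\ell^T=0$ and $E^T\mathcal G_{po}A+A^T\mathcal G_{po}E+P_r^TC^TCP_r=0$; 3. $\mathcal G_{pc}E^T\mathcal G_{po}E=\varsigma^2P_r$ and $\mathcal G_{po}E\mathcal G_{pc}E^T=\varsigma^2P_\ell^T$; 4. $M_0M_0^T=\varsigma^2I_m$ and $M_k=0$ for all $k\ge1$; 5. $M_0^TCP_r+B^T\mathcal G_{po}E=0$ and $M_0B^TP_\ell^T+C\mathcal G_{pc}E^T=0$.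 -/

import Mathlib

open Matrix Polynomial

/-- A linear time-invariant descriptor system `E x' = A x + B u`, `y = C x + D u`
with real coefficient matrices. -/
structure DescriptorSystem (n m p : ℕ) where
  E : Matrix (Fin n) (Fin n) ℝ
  A : Matrix (Fin n) (Fin n) ℝ
  B : Matrix (Fin n) (Fin m) ℝ
  C : Matrix (Fin p) (Fin n) ℝ
  D : Matrix (Fin p) (Fin m) ℝ

/-- The matrix `z E - A`, for `z` in a field extension `K` of `ℝ`. It is used for complex numbers
`z` and for the indeterminate of the field of rational functions. -/
def matrixPencil {n : ℕ} {K : Type*} [Field K] [Algebra ℝ K]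
    (E A : Matrix (Fin n) (Fin n) ℝ) (z : K) : Matrix (Fin n) (Fin n) K :=
  z • E.map (algebraMap ℝ K) - A.map (algebraMap ℝ K)

/-- The pencil `λ E - A` is regular: `det (λ E - A) ≠ 0` for at least one complex `λ`. -/
def IsRegularPencil {n : ℕ} (E A : Matrix (Fin n) (Fin n) ℝ) : Prop :=
  ∃ z : ℂ, (matrixPencil E A z).det ≠ 0

/-- A (block) Weierstrass form of the pencil `λ E - A` over a field `K`: invertible `W`, `T` with
`W (λ E - A) T = λ diag (1, N) - diag (J, 1)` and `N` nilpotent. The bijection `ι` only orders the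
block indices. A further reduction of `J` and `N` to Jordan form is not demanded: it does not
change the spectral projectors, see
`WeierstrassForm.projectors_unique` and `WeierstrassForm.projectors_map`. -/
structure WeierstrassForm {K : Type*} [Field K] {n : ℕ} (E A : Matrix (Fin n) (Fin n) K) where
  nf : ℕ
  ni : ℕ
  ι : Fin nf ⊕ Fin ni ≃ Fin n
  W : Matrix (Fin n) (Fin n) K
  T : Matrix (Fin n) (Fin n) K
  isUnit_W : IsUnit W
  isUnit_T : IsUnit T
  J : Matrix (Fin nf) (Fin nf) K
  N : Matrix (Fin ni) (Fin ni) K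
  isNilpotent_N : IsNilpotent N
  E_eq : W * E * T = reindex ι ι (fromBlocks 1 0 0 N)
  A_eq : W * A * T = reindex ι ι (fromBlocks J 0 0 1)

namespace WeierstrassForm

variable {K : Type*} [Field K] {n : ℕ} {E A : Matrix (Fin n) (Fin n) K}

/-- The projector onto the left deflating subspace of the finite eigenvalues. -/
noncomputable def left (F : WeierstrassForm E A) : Matrix (Fin n) (Fin n) K :=
  F.W⁻¹ * reindex F.ι F.ι (fromBlocks 1 0 0 0) * F.W

/-- The projector onto the right deflating subspace of the finite eigenvalues. -/
noncomputable def right (F : WeierstrassForm E A) : Matrix (Fin n) (Fin n) K :=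
  F.T * reindex F.ι F.ι (fromBlocks 1 0 0 0) * F.T⁻¹

end WeierstrassForm

theorem fromBlocks_zero_zero_pow {K : Type*} [Field K] {a b : ℕ} (X : Matrix (Fin a) (Fin a) K)
    (Y : Matrix (Fin b) (Fin b) K) (j : ℕ) :
    fromBlocks X 0 0 Y ^ j = fromBlocks (X ^ j) 0 0 (Y ^ j) := by
  induction j with
  | zero => simp
  | succ j ih => rw [pow_succ, ih, fromBlocks_multiply]; simp [pow_succ]

/-- Fitting decomposition of a square matrix. -/
theorem exists_fitting_form {K : Type*} [Field K] {n : ℕ} (M : Matrix (Fin n) (Fin n) K) :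
    ∃ (nf ni : ℕ) (ι : Fin nf ⊕ Fin ni ≃ Fin n) (T : Matrix (Fin n) (Fin n) K)
      (M₁ : Matrix (Fin nf) (Fin nf) K) (M₂ : Matrix (Fin ni) (Fin ni) K),
      IsUnit T ∧ IsUnit M₁ ∧ IsNilpotent M₂ ∧
        T⁻¹ * M * T = reindex ι ι (fromBlocks M₁ 0 0 M₂) := by
  classical
  set f : Module.End K (Fin n → K) := Matrix.toLin' M with hf
  obtain ⟨k₀, hk₀⟩ := Filter.eventually_atTop.mp f.eventually_isCompl_ker_pow_range_pow
  set k := k₀ + 1 with hk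
  have hc : IsCompl (LinearMap.range (f ^ k)) (LinearMap.ker (f ^ k)) := (hk₀ k (by omega)).symm
  let bR := Module.finBasis K (LinearMap.range (f ^ k))
  let bN := Module.finBasis K (LinearMap.ker (f ^ k))
  let b := (bR.prod bN).map (Submodule.prodEquivOfIsCompl _ _ hc)
  let ι := b.indexEquiv (Pi.basisFun K (Fin n))
  let c := b.reindex ι
  have hbl : ∀ i, b (Sum.inl i) = (bR i : Fin n → K) := fun i => by simp [b]
  have hbr : ∀ i, b (Sum.inr i) = (bN i : Fin n → K) := fun i => by simp [b]
  set L := LinearMap.toMatrix b b f with hL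
  have hrl : ∀ x : LinearMap.range (f ^ k), ∀ i, b.repr (x : Fin n → K) (Sum.inr i) = 0 := by
    intro x i
    have : (Submodule.prodEquivOfIsCompl _ _ hc).symm (x : Fin n → K) = (x, 0) :=
      Submodule.prodEquivOfIsCompl_symm_apply_left _ _ hc x
    simp [b, this]
  have hrr : ∀ x : LinearMap.ker (f ^ k), ∀ i, b.repr (x : Fin n → K) (Sum.inl i) = 0 := by
    intro x i
    have : (Submodule.prodEquivOfIsCompl _ _ hc).symm (x : Fin n → K) = (0, x) :=
      Submodule.prodEquivOfIsCompl_symm_apply_right _ _ hc x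
    simp [b, this]
  have hcomm : ∀ x, (f ^ k) (f x) = f ((f ^ k) x) := fun x => by
    rw [← Module.End.mul_apply, ← Module.End.mul_apply, ← pow_succ, ← pow_succ']
  have h21 : L.toBlocks₂₁ = 0 := by
    ext i j
    obtain ⟨y, hy⟩ := (bR j).2
    have := hrl ⟨f (bR j), ⟨f y, by rw [hcomm, hy]⟩⟩ i
    simpa [L, toBlocks₂₁, LinearMap.toMatrix_apply, hbl] using this
  have h12 : L.toBlocks₁₂ = 0 := by
    ext i j
    have hy : (f ^ k) (bN j : Fin n → K) = 0 := (bN j).2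
    have := hrr ⟨f (bN j), by rw [LinearMap.mem_ker, hcomm, hy, map_zero]⟩ i
    simpa [L, toBlocks₁₂, LinearMap.toMatrix_apply, hbr] using this
  have hLb : L = fromBlocks L.toBlocks₁₁ 0 0 L.toBlocks₂₂ := by
    conv_lhs => rw [← fromBlocks_toBlocks L, h21, h12]
  have hpow : ∀ j : ℕ, L ^ j = fromBlocks (L.toBlocks₁₁ ^ j) 0 0 (L.toBlocks₂₂ ^ j) := by
    intro j
    conv_lhs => rw [hLb]
    exact fromBlocks_zero_zero_pow _ _ j
  have hLk : L ^ k = LinearMap.toMatrix b b (f ^ k) := by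
    rw [hL, LinearMap.toMatrix_pow]
  refine ⟨_, _, ι, (Pi.basisFun K (Fin n)).toMatrix c, L.toBlocks₁₁, L.toBlocks₂₂,
    ?_, ?_, ⟨k, ?_⟩, ?_⟩
  · have := (Pi.basisFun K (Fin n)).invertibleToMatrix c
    exact isUnit_of_invertible _
  · rw [← Matrix.mulVec_injective_iff_isUnit]
    intro v w hvw
    have hv : L.toBlocks₁₁ *ᵥ (v - w) = 0 := by
      rw [Matrix.mulVec_sub]; exact sub_eq_zero.mpr hvw
    set u := v - w
    let x : Fin n → K := b.equivFun.symm (Sum.elim u 0)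
    have hx : x = ((∑ i, u i • bR i : LinearMap.range (f ^ k)) : Fin n → K) := by
      simp [x, Module.Basis.equivFun_symm_apply, hbl]
    have hfx : f x = 0 := by
      have h1 : L *ᵥ (Sum.elim u 0) = 0 := by
        rw [hLb, fromBlocks_mulVec]
        ext i; cases i <;> simp [hv]
      have h2 : L *ᵥ (b.repr x) = b.repr (f x) := LinearMap.toMatrix_mulVec_repr b b f x
      have h3 : (b.repr x : _ → K) = Sum.elim u 0 := by
        have := b.equivFun.apply_symm_apply (Sum.elim u 0)
        rw [← this]; rfl
      rw [h3, h1] at h2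
      apply b.repr.injective
      ext i
      simp [← congrFun h2 i]
    have hxk : x ∈ LinearMap.ker (f ^ k) := by
      rw [LinearMap.mem_ker, hk, pow_succ, Module.End.mul_apply, hfx, map_zero]
    have hx0 : x = 0 := by
      have hxr : x ∈ LinearMap.range (f ^ k) := by rw [hx]; exact Subtype.prop _
      exact (Submodule.disjoint_def.mp hc.disjoint) x hxr hxk
    have hu : u = 0 := by
      have h0 : b.equivFun x = Sum.elim u 0 := b.equivFun.apply_symm_apply (Sum.elim u 0)
      rw [hx0, map_zero] at h0
      ext i; simpa using (congrFun h0 (Sum.inl i)).symm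
    exact sub_eq_zero.mp hu
  · have h := hpow k
    ext i j
    have h' : (L ^ k) (Sum.inr i) (Sum.inr j) = (L.toBlocks₂₂ ^ k) i j := by rw [h]; rfl
    rw [← h', hLk, LinearMap.toMatrix_apply, hbr]
    have hy : (f ^ k) (bN j : Fin n → K) = 0 := (bN j).2
    simp [hy]
  · have hT : ((Pi.basisFun K (Fin n)).toMatrix c)⁻¹ = c.toMatrix (Pi.basisFun K (Fin n)) :=
      Matrix.inv_eq_left_inv (Module.Basis.toMatrix_mul_toMatrix_flip _ _)
    have hM : M = LinearMap.toMatrix (Pi.basisFun K (Fin n)) (Pi.basisFun K (Fin n)) f := by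
      rw [hf, LinearMap.toMatrix_eq_toMatrix', LinearMap.toMatrix'_toLin']
    rw [hT, ← hLb]
    conv_lhs => rw [hM]
    rw [basis_toMatrix_mul_linearMap_toMatrix_mul_basis_toMatrix]
    ext i j
    simp [c, L, LinearMap.toMatrix_apply]

/-- A regular real pencil has a Weierstrass form. -/
theorem IsRegularPencil.exists_weierstrassForm {n : ℕ} {E A : Matrix (Fin n) (Fin n) ℝ}
    (h : IsRegularPencil E A) : Nonempty (WeierstrassForm E A) := by
  classical
  let Q : ℝ[X] := ((X : ℝ[X]) • E.map (C : ℝ →+* ℝ[X]) - A.map (C : ℝ →+* ℝ[X])).det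
  have hev : ∀ {R : Type} [Field R] [Algebra ℝ R] (z : R),
      aeval z Q = (matrixPencil E A z).det := by
    intro R _ _ z
    rw [AlgHom.map_det]
    congr 1
    ext i j
    simp [matrixPencil, mul_comm z]
  have hQ : Q ≠ 0 := by
    obtain ⟨z, hz⟩ := h
    rintro h0
    exact hz (by rw [← hev z, h0, map_zero])
  obtain ⟨μ, hμ⟩ : ∃ μ : ℝ, Q.eval μ ≠ 0 := by
    by_contra! hall
    exact hQ (Polynomial.funext (by simpa using hall))
  have hdet : (μ • E - A).det ≠ 0 := by
    have := hev (R := ℝ) μ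
    rw [coe_aeval_eq_eval] at this
    rw [this] at hμ
    simpa [matrixPencil] using hμ
  set M := μ • E - A with hM
  have hMu : IsUnit M := (Matrix.isUnit_iff_isUnit_det _).mpr (isUnit_iff_ne_zero.mpr hdet)
  have hMd : IsUnit M.det := (Matrix.isUnit_iff_isUnit_det _).mp hMu
  obtain ⟨nf, ni, ι, T, K₁, K₂, hT, hK₁, hK₂, hfit⟩ := exists_fitting_form (M⁻¹ * E)
  have hTd : IsUnit T.det := (Matrix.isUnit_iff_isUnit_det _).mp hT
  have hL : IsUnit (μ • K₂ - 1) := by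
    have : IsNilpotent (μ • K₂) := by
      obtain ⟨k, hk⟩ := hK₂
      exact ⟨k, by rw [_root_.smul_pow, hk, smul_zero]⟩
    exact this.isUnit_sub_one
  set L := μ • K₂ - 1 with hLdef
  have hLd : IsUnit L.det := (Matrix.isUnit_iff_isUnit_det _).mp hL
  have hK₁d : IsUnit K₁.det := (Matrix.isUnit_iff_isUnit_det _).mp hK₁
  have hA : T⁻¹ * (M⁻¹ * A) * T = reindex ι ι (fromBlocks (μ • K₁ - 1) 0 0 L) := by
    have h1 : M⁻¹ * A = μ • (M⁻¹ * E) - 1 := by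
      have : A = μ • E - M := by rw [hM]; abel
      conv_lhs => rw [this]
      rw [mul_sub, Matrix.nonsing_inv_mul _ hMd, Matrix.mul_smul]
    rw [h1, mul_sub, sub_mul, Matrix.mul_smul, Matrix.smul_mul, hfit, mul_one,
      Matrix.nonsing_inv_mul _ hTd]
    ext i j
    obtain ⟨i, rfl⟩ := ι.surjective i
    obtain ⟨j, rfl⟩ := ι.surjective j
    rcases i with a | a <;> rcases j with b | b <;>
      simp [hLdef, Matrix.one_apply]
  have hS : IsUnit (reindex ι ι (fromBlocks K₁⁻¹ 0 0 L⁻¹)) := by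
    apply IsUnit.of_mul_eq_one (reindex ι ι (fromBlocks K₁ 0 0 L))
    simp [reindex_apply, submatrix_mul_equiv, fromBlocks_multiply,
      Matrix.nonsing_inv_mul _ hK₁d, Matrix.nonsing_inv_mul _ hLd]
  refine ⟨{ nf := nf, ni := ni, ι := ι
            W := reindex ι ι (fromBlocks K₁⁻¹ 0 0 L⁻¹) * (T⁻¹ * M⁻¹), T := T
            isUnit_W := ?_, isUnit_T := hT
            J := K₁⁻¹ * (μ • K₁ - 1), N := L⁻¹ * K₂
            isNilpotent_N := ?_, E_eq := ?_, A_eq := ?_ }⟩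
  · refine hS.mul (IsUnit.mul ?_ ?_)
    · exact Matrix.isUnit_nonsing_inv_iff.mpr hT
    · exact Matrix.isUnit_nonsing_inv_iff.mpr hMu
  · have hc : Commute L⁻¹ K₂ := by
      have h1 : Commute L K₂ := by
        rw [hLdef]
        exact ((Commute.refl K₂).smul_left μ).sub_left (Commute.one_left K₂)
      have h2 : L⁻¹ * K₂ = L⁻¹ * (K₂ * L) * L⁻¹ := by
        rw [mul_assoc, mul_assoc, Matrix.mul_nonsing_inv _ hLd, mul_one]
      change L⁻¹ * K₂ = K₂ * L⁻¹
      rw [h2, ← h1.eq, ← mul_assoc, Matrix.nonsing_inv_mul _ hLd, one_mul]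
    exact hc.isNilpotent_mul_left hK₂
  · have : reindex ι ι (fromBlocks K₁⁻¹ 0 0 L⁻¹) * (T⁻¹ * M⁻¹) * E * T
        = reindex ι ι (fromBlocks K₁⁻¹ 0 0 L⁻¹) * (T⁻¹ * (M⁻¹ * E) * T) := by
      simp only [mul_assoc]
    rw [this, hfit]
    simp [reindex_apply, submatrix_mul_equiv, fromBlocks_multiply,
      Matrix.nonsing_inv_mul _ hK₁d]
  · have : reindex ι ι (fromBlocks K₁⁻¹ 0 0 L⁻¹) * (T⁻¹ * M⁻¹) * A * T
        = reindex ι ι (fromBlocks K₁⁻¹ 0 0 L⁻¹) * (T⁻¹ * (M⁻¹ * A) * T) := by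
      simp only [mul_assoc]
    rw [this, hA]
    simp [reindex_apply, submatrix_mul_equiv, fromBlocks_multiply,
      Matrix.nonsing_inv_mul _ hLd]

/-- Between two Weierstrass forms of one pencil, the transition matrices are block diagonal. -/
theorem weierstrass_blocks {K : Type*} [Field K] {a b a' b' : ℕ}
    {J : Matrix (Fin a) (Fin a) K} {N : Matrix (Fin b) (Fin b) K}
    {J' : Matrix (Fin a') (Fin a') K} {N' : Matrix (Fin b') (Fin b') K}
    (hN : IsNilpotent N) (hN' : IsNilpotent N')
    {Y Z : Matrix (Fin a ⊕ Fin b) (Fin a' ⊕ Fin b') K}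
    (hE : (fromBlocks 1 0 0 N : Matrix (Fin a ⊕ Fin b) (Fin a ⊕ Fin b) K) * Y
      = Z * (fromBlocks 1 0 0 N' : Matrix (Fin a' ⊕ Fin b') (Fin a' ⊕ Fin b') K))
    (hA : (fromBlocks J 0 0 1 : Matrix (Fin a ⊕ Fin b) (Fin a ⊕ Fin b) K) * Y
      = Z * (fromBlocks J' 0 0 1 : Matrix (Fin a' ⊕ Fin b') (Fin a' ⊕ Fin b') K)) :
    ((fromBlocks 1 0 0 0 : Matrix (Fin a ⊕ Fin b) (Fin a ⊕ Fin b) K) * Y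
        = Y * (fromBlocks 1 0 0 0 : Matrix (Fin a' ⊕ Fin b') (Fin a' ⊕ Fin b') K)) ∧
      ((fromBlocks 1 0 0 0 : Matrix (Fin a ⊕ Fin b) (Fin a ⊕ Fin b) K) * Z
        = Z * (fromBlocks 1 0 0 0 : Matrix (Fin a' ⊕ Fin b') (Fin a' ⊕ Fin b') K)) := by
  rw [← fromBlocks_toBlocks Y, ← fromBlocks_toBlocks Z] at hE hA ⊢
  generalize Y.toBlocks₁₁ = Y₁, Y.toBlocks₁₂ = Y₂, Y.toBlocks₂₁ = Y₃, Y.toBlocks₂₂ = Y₄ at *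
  generalize Z.toBlocks₁₁ = Z₁, Z.toBlocks₁₂ = Z₂, Z.toBlocks₂₁ = Z₃, Z.toBlocks₂₂ = Z₄ at *
  simp only [fromBlocks_multiply, fromBlocks_inj, Matrix.one_mul, Matrix.mul_one, Matrix.zero_mul,
    Matrix.mul_zero, add_zero, zero_add] at hE hA ⊢
  obtain ⟨-, e2, e3, -⟩ := hE
  obtain ⟨-, a2, a3, -⟩ := hA
  have hY₂ : Y₂ = 0 := by
    have h : ∀ k : ℕ, Y₂ = J ^ k * Y₂ * N' ^ k := by
      intro k
      induction k with
      | zero => simp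
      | succ k ih =>
        rw [pow_succ, pow_succ']
        have : J ^ k * J * Y₂ * (N' * N' ^ k) = J ^ k * (J * Y₂ * N') * N' ^ k := by
          simp only [Matrix.mul_assoc]
        rw [this, a2, ← e2]
        exact ih
    obtain ⟨k, hk⟩ := hN'
    rw [h k, hk, Matrix.mul_zero]
  have hY₃ : Y₃ = 0 := by
    have h : ∀ k : ℕ, Y₃ = N ^ k * Y₃ * J' ^ k := by
      intro k
      induction k with
      | zero => simp
      | succ k ih =>
        rw [pow_succ, pow_succ']
        have : N ^ k * N * Y₃ * (J' * J' ^ k) = N ^ k * (N * Y₃ * J') * J' ^ k := by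
          simp only [Matrix.mul_assoc]
        rw [this, e3, ← a3]
        exact ih
    obtain ⟨k, hk⟩ := hN
    rw [h k, hk, Matrix.zero_mul, Matrix.zero_mul]
  have hZ₂ : Z₂ = 0 := by rw [← a2, hY₂, Matrix.mul_zero]
  have hZ₃ : Z₃ = 0 := by rw [← e3, hY₃, Matrix.mul_zero]
  simp [hY₂, hY₃, hZ₂, hZ₃]

namespace WeierstrassForm

variable {K : Type*} [Field K] {n : ℕ} {E A : Matrix (Fin n) (Fin n) K}

/-- The spectral projectors do not depend on the chosen Weierstrass form. -/
theorem projectors_unique (F F' : WeierstrassForm E A) :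
    F.left = F'.left ∧ F.right = F'.right := by
  classical
  have hW := (Matrix.isUnit_iff_isUnit_det _).mp F.isUnit_W
  have hT := (Matrix.isUnit_iff_isUnit_det _).mp F.isUnit_T
  have hW' := (Matrix.isUnit_iff_isUnit_det _).mp F'.isUnit_W
  have hT' := (Matrix.isUnit_iff_isUnit_det _).mp F'.isUnit_T
  set Y := F.T⁻¹ * F'.T with hY
  set Z := F.W * F'.W⁻¹ with hZ
  have key : ∀ M : Matrix (Fin n) (Fin n) K,
      (F.W * M * F.T) * Y = Z * (F'.W * M * F'.T) := by
    intro M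
    calc (F.W * M * F.T) * Y = F.W * M * (F.T * F.T⁻¹) * F'.T := by
          rw [hY]; simp only [Matrix.mul_assoc]
      _ = F.W * M * F'.T := by rw [Matrix.mul_nonsing_inv _ hT, Matrix.mul_one]
      _ = F.W * (F'.W⁻¹ * F'.W) * M * F'.T := by
          rw [Matrix.nonsing_inv_mul _ hW', Matrix.mul_one]
      _ = _ := by rw [hZ]; simp only [Matrix.mul_assoc]
  have sub : ∀ (P : Matrix (Fin F.nf ⊕ Fin F.ni) (Fin F.nf ⊕ Fin F.ni) K)
      (P' : Matrix (Fin F'.nf ⊕ Fin F'.ni) (Fin F'.nf ⊕ Fin F'.ni) K)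
      (U V : Matrix (Fin n) (Fin n) K),
      reindex F.ι F.ι P * U = V * reindex F'.ι F'.ι P' ↔
        P * U.submatrix F.ι F'.ι = V.submatrix F.ι F'.ι * P' := by
    intro P P' U V
    have h1 : (reindex F.ι F.ι P * U).submatrix F.ι F'.ι = P * U.submatrix F.ι F'.ι := by
      rw [← Matrix.submatrix_mul_equiv _ _ F.ι F.ι F'.ι]; simp
    have h2 : (V * reindex F'.ι F'.ι P').submatrix F.ι F'.ι = V.submatrix F.ι F'.ι * P' := by
      rw [← Matrix.submatrix_mul_equiv _ _ F.ι F'.ι F'.ι]; simp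
    rw [← h1, ← h2]
    exact (Matrix.reindex F.ι.symm F'.ι.symm).injective.eq_iff.symm
  have hE := key E
  have hA := key A
  rw [F.E_eq, F'.E_eq, sub] at hE
  rw [F.A_eq, F'.A_eq, sub] at hA
  obtain ⟨c1, c2⟩ := weierstrass_blocks F.isNilpotent_N F'.isNilpotent_N hE hA
  rw [← sub] at c1 c2
  constructor
  · calc F.left = F.W⁻¹ * (reindex F.ι F.ι (fromBlocks 1 0 0 0) * Z) * F'.W := by
          rw [left, hZ]
          simp only [Matrix.mul_assoc]
          rw [Matrix.nonsing_inv_mul _ hW', Matrix.mul_one]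
      _ = (F.W⁻¹ * F.W) * F'.W⁻¹ * reindex F'.ι F'.ι (fromBlocks 1 0 0 0) * F'.W := by
          rw [c2, hZ]; simp only [Matrix.mul_assoc]
      _ = F'.left := by rw [Matrix.nonsing_inv_mul _ hW, Matrix.one_mul, left]
  · calc F.right = F.T * (reindex F.ι F.ι (fromBlocks 1 0 0 0) * Y) * F'.T⁻¹ := by
          rw [right, hY]
          simp only [Matrix.mul_assoc]
          rw [Matrix.mul_nonsing_inv _ hT', Matrix.mul_one]
      _ = (F.T * F.T⁻¹) * F'.T * reindex F'.ι F'.ι (fromBlocks 1 0 0 0) * F'.T⁻¹ := by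
          rw [c1, hY]; simp only [Matrix.mul_assoc]
      _ = F'.right := by rw [Matrix.mul_nonsing_inv _ hT, Matrix.one_mul, right]

/-- Extension of scalars of a Weierstrass form. -/
def map {L : Type*} [Field L] (f : K →+* L) (F : WeierstrassForm E A) :
    WeierstrassForm (E.map f) (A.map f) where
  nf := F.nf
  ni := F.ni
  ι := F.ι
  W := F.W.map f
  T := F.T.map f
  isUnit_W := F.isUnit_W.map f.mapMatrix
  isUnit_T := F.isUnit_T.map f.mapMatrix
  J := F.J.map f
  N := F.N.map f
  isNilpotent_N := F.isNilpotent_N.map f.mapMatrix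
  E_eq := by
    rw [← Matrix.map_mul, ← Matrix.map_mul, F.E_eq]
    simp [reindex_apply, ← Matrix.submatrix_map, fromBlocks_map]
  A_eq := by
    rw [← Matrix.map_mul, ← Matrix.map_mul, F.A_eq]
    simp [reindex_apply, ← Matrix.submatrix_map, fromBlocks_map]

/-- The spectral projectors computed over any extension field, for instance from a complex
Jordan-type Weierstrass form of a real pencil, are the same. -/
theorem projectors_map {L : Type*} [Field L] (f : K →+* L) (F : WeierstrassForm E A)
    (F' : WeierstrassForm (E.map f) (A.map f)) :
    F'.left = F.left.map f ∧ F'.right = F.right.map f := by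
  have hinv : ∀ M : Matrix (Fin n) (Fin n) K, IsUnit M → (M.map f)⁻¹ = M⁻¹.map f := by
    intro M hM
    apply Matrix.inv_eq_left_inv
    rw [← Matrix.map_mul, Matrix.nonsing_inv_mul _ ((Matrix.isUnit_iff_isUnit_det _).mp hM)]
    simp
  have h := projectors_unique F' (F.map f)
  rw [h.1, h.2]
  constructor
  · simp only [left, map, hinv _ F.isUnit_W, Matrix.map_mul, reindex_apply]
    simp [← Matrix.submatrix_map, fromBlocks_map]
    rfl
  · simp only [right, map, hinv _ F.isUnit_T, Matrix.map_mul, reindex_apply]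
    simp [← Matrix.submatrix_map, fromBlocks_map]
    rfl

end WeierstrassForm

namespace DescriptorSystem

variable {n m p : ℕ}

/-- The pencil `λ E - A` of the system is regular. -/
def IsRegular (S : DescriptorSystem n m p) : Prop := IsRegularPencil S.E S.A

/-- `P_ℓ`, the spectral projector onto the left deflating subspace of the finite eigenvalues. -/
noncomputable def leftProjector (S : DescriptorSystem n m p) (h : S.IsRegular) :
    Matrix (Fin n) (Fin n) ℝ :=
  (Classical.choice h.exists_weierstrassForm).left

/-- `P_r`, the spectral projector onto the right deflating subspace of the finite eigenvalues. -/
noncomputable def rightProjector (S : DescriptorSystem n m p) (h : S.IsRegular) :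
    Matrix (Fin n) (Fin n) ℝ :=
  (Classical.choice h.exists_weierstrassForm).right

/-- R-controllability: `rank [λ E - A, B] = n` for all complex `λ`. -/
def RControllable (S : DescriptorSystem n m p) : Prop :=
  ∀ z : ℂ, (fromCols (matrixPencil S.E S.A z) (S.B.map (algebraMap ℝ ℂ))).rank = n

/-- R-observability: `rank [λ E - A; C] = n` for all complex `λ`. -/
def RObservable (S : DescriptorSystem n m p) : Prop :=
  ∀ z : ℂ, (fromRows (matrixPencil S.E S.A z) (S.C.map (algebraMap ℝ ℂ))).rank = n

/-- The transfer function `G(z) = C (z E - A)⁻¹ B + D`, at a complex number `z` or, as a matrix of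
rational functions, at the indeterminate. -/
noncomputable def transfer (S : DescriptorSystem n m p) {K : Type*} [Field K] [Algebra ℝ K]
    (z : K) : Matrix (Fin p) (Fin m) K :=
  S.C.map (algebraMap ℝ K) * (matrixPencil S.E S.A z)⁻¹ * S.B.map (algebraMap ℝ K)
    + S.D.map (algebraMap ℝ K)

/-- `G(s) G(-s)ᵀ = ς² I` for all complex `s` for which both `G(s)` and `G(-s)` are defined by the
formula `C (s E - A)⁻¹ B + D`. -/
def IsAllPass (S : DescriptorSystem n m m) (ς : ℝ) : Prop :=
  ∀ s : ℂ, (matrixPencil S.E S.A s).det ≠ 0 → (matrixPencil S.E S.A (-s)).det ≠ 0 →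
    S.transfer s * (S.transfer (-s))ᵀ = ((ς : ℂ) ^ 2) • (1 : Matrix (Fin m) (Fin m) ℂ)

/-- The polynomial part of the transfer function: entrywise, the quotient of the numerator by the
denominator. -/
noncomputable def polynomialPart (S : DescriptorSystem n m p) : Matrix (Fin p) (Fin m) ℝ[X] :=
  (S.transfer (RatFunc.X : RatFunc ℝ)).map fun f => f.num / f.denom

/-- The strictly proper part of the transfer function. -/
noncomputable def strictlyProperPart (S : DescriptorSystem n m p) :
    Matrix (Fin p) (Fin m) (RatFunc ℝ) :=
  S.transfer (RatFunc.X : RatFunc ℝ) - S.polynomialPart.map (algebraMap ℝ[X] (RatFunc ℝ))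

/-- The coefficient `M_k` of `s ^ k` in the polynomial part of the transfer function. -/
noncomputable def polynomialCoeff (S : DescriptorSystem n m p) (k : ℕ) :
    Matrix (Fin p) (Fin m) ℝ :=
  S.polynomialPart.map fun q => q.coeff k

/-- Every entry of the strictly proper part has a numerator of smaller degree than its
denominator. -/
theorem strictlyProperPart_degree_lt (S : DescriptorSystem n m p) (i : Fin p) (j : Fin m) :
    (S.strictlyProperPart i j).num.degree < (S.strictlyProperPart i j).denom.degree := by
  set f := S.transfer (RatFunc.X : RatFunc ℝ) i j with hf
  have hd : f.denom ≠ 0 := f.denom_ne_zero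
  have hd' : algebraMap ℝ[X] (RatFunc ℝ) f.denom ≠ 0 := RatFunc.algebraMap_ne_zero hd
  have hr : S.strictlyProperPart i j
      = algebraMap ℝ[X] (RatFunc ℝ) (f.num % f.denom) / algebraMap ℝ[X] (RatFunc ℝ) f.denom := by
    have h1 : S.strictlyProperPart i j = f - algebraMap ℝ[X] (RatFunc ℝ) (f.num / f.denom) := rfl
    rw [h1, eq_div_iff hd', sub_mul, ← map_mul]
    conv_lhs => rw [← RatFunc.num_div_denom f]
    rw [RatFunc.num_div_denom f]
    have h2 : f * algebraMap ℝ[X] (RatFunc ℝ) f.denom = algebraMap ℝ[X] (RatFunc ℝ) f.num := by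
      conv_lhs => rw [← RatFunc.num_div_denom f]
      rw [RatFunc.num_div_denom f]
      exact (eq_div_iff hd').mp (RatFunc.num_div_denom f).symm
    rw [h2, ← map_sub]
    congr 1
    have := EuclideanDomain.div_add_mod f.num f.denom
    linear_combination -this
  have hcross : (S.strictlyProperPart i j).num * f.denom
      = (f.num % f.denom) * (S.strictlyProperPart i j).denom :=
    (RatFunc.num_mul_eq_mul_denom_iff hd).mpr hr
  set r := S.strictlyProperPart i j
  by_cases h0 : r.num = 0
  · rw [h0, degree_zero, bot_lt_iff_ne_bot, Ne, degree_eq_bot]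
    exact r.denom_ne_zero
  have hlt : (f.num % f.denom).degree < f.denom.degree := EuclideanDomain.mod_lt _ hd
  by_contra! hle
  have h1 := congrArg degree hcross
  rw [degree_mul, degree_mul] at h1
  have hm0 : f.num % f.denom ≠ 0 := by
    intro hz
    rw [hz, zero_mul] at hcross
    exact (mul_ne_zero h0 hd) hcross
  rw [degree_eq_natDegree h0, degree_eq_natDegree hd, degree_eq_natDegree hm0,
    degree_eq_natDegree r.denom_ne_zero] at h1
  rw [degree_eq_natDegree h0, degree_eq_natDegree r.denom_ne_zero] at hle
  rw [degree_eq_natDegree hm0, degree_eq_natDegree hd] at hlt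
  norm_cast at h1 hle hlt
  omega

end DescriptorSystem

/-! In Weierstrass coordinates the transfer function is `C T₁ (s - J)⁻¹ W₁ B + ∑ s ^ k M_k`: a
standard state space system `(J, W₁ B, C T₁)` plus a polynomial produced by the nilpotent block
(`transfer_eq`, `polynomialCoeff_eq`). By the Popov-Belevitch-Hautus test, R-controllability and
R-observability make the standard part minimal. The projectors factor as `P_ℓ = V₁ W₁` and `P_r = T₁
U₁`, with `E T₁ = V₁` and `W₁ E = U₁`. Taking `Gpc = T₁ X T₁ᵀ` and `Gpo = W₁ᵀ Y W₁` therefore turns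
the generalized equations into ordinary equations for `X` and `Y`.

An all-pass function cannot grow: a top coefficient `M_k` with `k ≥ 1` would contribute `± s ^ (2k)
M_k M_kᵀ`, and over the reals `M_k M_kᵀ = 0` forces `M_k = 0`
(`polynomial_coeff_eq_zero_of_allPass`). Letting `s → ∞` then gives `M₀ M₀ᵀ = ς² I`.

For the remaining proper function `G(s) = D + C (s - J)⁻¹ B`, now with `D = M₀` and with `B`, `C`
those of the standard part, the identity reads `G(-s)ᵀ = ς² G(s)⁻¹`. The left side is realized by
`(-Jᵀ, Cᵀ, -Bᵀ)`, the right side by `(J - B D⁻¹ C, B D⁻¹, -Dᵀ C)`, both with feedthrough `Dᵀ` and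
both minimal. Equal transfer functions have equal Markov parameters, so an invertible `Z`
intertwines the two realizations. Its three intertwining relations, rewritten for `X = -ς² Z`, are
the Lyapunov equation and the coupling relation. Observability forces `X` to be symmetric, and `Y =
ς² X⁻¹` satisfies the dual equations (`exists_gramians_of_allPass`).

Conversely, the Lyapunov equation for `X` says `B Bᵀ = (s - J) X + X (-s - J)ᵀ`. Substituted into
`G(s) G(-s)ᵀ`, with `D Bᵀ = -C X`, it cancels everything except `D Dᵀ` (`allPass_of_gramian`). -/

/-! ### Resolvents at infinity and Markov parameters. -/

section StateSpace

open Filter Topology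

variable {ν μ κ : Type*} [Fintype ν] [DecidableEq ν]

theorem tendsto_smul_resolvent (A : Matrix ν ν ℝ) :
    Tendsto (fun s : ℝ => s • (s • (1 : Matrix ν ν ℝ) - A)⁻¹) atTop (𝓝 1) := by
  have h1 : Tendsto (fun s : ℝ => (1 - s⁻¹ • A)) atTop (𝓝 (1 : Matrix ν ν ℝ)) := by
    have : Tendsto (fun s : ℝ => (1 - s⁻¹ • A)) atTop (𝓝 (1 - (0 : ℝ) • A)) :=
      tendsto_const_nhds.sub (tendsto_inv_atTop_zero.smul_const A)
    simpa using this
  have h2 : ContinuousAt (Inv.inv : Matrix ν ν ℝ → Matrix ν ν ℝ) 1 := by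
    apply continuousAt_matrix_inv
    rw [det_one]
    exact NormedRing.inverse_continuousAt (1 : ℝˣ)
  have h3 := h2.tendsto.comp h1
  rw [inv_one] at h3
  refine h3.congr' ?_
  filter_upwards [eventually_gt_atTop 0] with s hs
  have h4 : s • (1 : Matrix ν ν ℝ) - A = s • (1 - s⁻¹ • A) := by
    rw [smul_sub, smul_smul, mul_inv_cancel₀ hs.ne', one_smul]
  simp only [Function.comp]
  by_cases hd : IsUnit (1 - s⁻¹ • A).det
  · symm
    have h5 := Matrix.inv_smul' (A := 1 - s⁻¹ • A) (Units.mk0 s hs.ne') hd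
    have h6 : (s • (1 - s⁻¹ • A))⁻¹ = s⁻¹ • (1 - s⁻¹ • A)⁻¹ := by
      simpa [Units.smul_def] using h5
    rw [h4, h6, smul_smul, mul_inv_cancel₀ hs.ne', one_smul]
  -- If `1 - s⁻¹ A` is singular then so is `s - A`, and both inverses are zero by convention.
  · rw [Matrix.nonsing_inv_apply_not_isUnit _ hd, h4, Matrix.nonsing_inv_apply_not_isUnit, smul_zero]
    rw [Matrix.det_smul]
    intro h
    exact hd (isUnit_of_mul_isUnit_right h)

theorem eventually_isUnit_resolvent (A : Matrix ν ν ℝ) :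
    ∀ᶠ s : ℝ in atTop, IsUnit (s • (1 : Matrix ν ν ℝ) - A).det := by
  have h := (A.charpoly).roots.toFinset.finite_toSet.isCompact.isBounded.bddAbove
  obtain ⟨b, hb⟩ := h
  filter_upwards [eventually_gt_atTop b] with s hs
  have h1 : (s • (1 : Matrix ν ν ℝ) - A).det = A.charpoly.eval s := by
    rw [Matrix.eval_charpoly, Matrix.scalar_apply, ← Matrix.smul_one_eq_diagonal]
  rw [h1, isUnit_iff_ne_zero]
  intro h0
  have : s ≤ b := hb (by simp [A.charpoly_monic.ne_zero, h0])
  linarith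

theorem tendsto_resolvent (A : Matrix ν ν ℝ) :
    Tendsto (fun s : ℝ => (s • (1 : Matrix ν ν ℝ) - A)⁻¹) atTop (𝓝 0) := by
  have h := tendsto_inv_atTop_zero (𝕜 := ℝ) |>.smul (tendsto_smul_resolvent A)
  rw [zero_smul] at h
  refine h.congr' ?_
  filter_upwards [eventually_gt_atTop 0] with s hs
  rw [smul_smul, inv_mul_cancel₀ hs.ne', one_smul]

/-- Turns limits at `-∞` into limits at `+∞` for `-A`. It holds at singular points too, where both
inverses are zero by convention. -/
theorem neg_resolvent_neg (A : Matrix ν ν ℝ) (s : ℝ) :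
    ((-s) • (1 : Matrix ν ν ℝ) - A)⁻¹ = -(s • (1 : Matrix ν ν ℝ) - -A)⁻¹ := by
  have h : (-s) • (1 : Matrix ν ν ℝ) - A = -(s • 1 - -A) := by rw [neg_smul]; abel
  rw [h]
  by_cases hd : IsUnit (s • (1 : Matrix ν ν ℝ) - -A).det
  · apply Matrix.inv_eq_left_inv
    rw [neg_mul_neg, Matrix.nonsing_inv_mul _ hd]
  · rw [Matrix.nonsing_inv_apply_not_isUnit _ hd, Matrix.nonsing_inv_apply_not_isUnit, neg_zero]
    rw [Matrix.det_neg]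
    intro h
    exact hd (isUnit_of_mul_isUnit_right h)

theorem tendsto_smul_mul_resolvent_mul (A : Matrix ν ν ℝ) (B : Matrix ν μ ℝ) (C : Matrix κ ν ℝ) :
    Tendsto (fun s : ℝ => s • (C * (s • (1 : Matrix ν ν ℝ) - A)⁻¹ * B)) atTop (𝓝 (C * B)) := by
  have h := (((continuous_const (y := C)).matrix_mul continuous_id).matrix_mul
    (continuous_const (y := B))).tendsto (1 : Matrix ν ν ℝ) |>.comp (tendsto_smul_resolvent A)
  simpa [Function.comp_def] using h

theorem tendsto_mul_resolvent_mul (A : Matrix ν ν ℝ) (B : Matrix ν μ ℝ) (C : Matrix κ ν ℝ) :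
    Tendsto (fun s : ℝ => C * (s • (1 : Matrix ν ν ℝ) - A)⁻¹ * B) atTop (𝓝 0) := by
  have h := (((continuous_const (y := C)).matrix_mul continuous_id).matrix_mul
    (continuous_const (y := B))).tendsto (0 : Matrix ν ν ℝ) |>.comp (tendsto_resolvent A)
  simpa [Function.comp_def] using h

/-- Write `A = s - (s - A)`. Replacing `B` by `A B` drops the leading Markov parameter and shifts
the others by one. -/
theorem mul_resolvent_mul_mul (A : Matrix ν ν ℝ) (B : Matrix ν μ ℝ) (C : Matrix κ ν ℝ) {s : ℝ}
    (hs : IsUnit (s • (1 : Matrix ν ν ℝ) - A).det) :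
    C * (s • (1 : Matrix ν ν ℝ) - A)⁻¹ * (A * B)
      = s • (C * (s • (1 : Matrix ν ν ℝ) - A)⁻¹ * B) - C * B := by
  have : A * B = s • B - (s • (1 : Matrix ν ν ℝ) - A) * B := by
    rw [Matrix.sub_mul, Matrix.smul_mul, Matrix.one_mul]; abel
  rw [this, Matrix.mul_sub, Matrix.mul_smul, Matrix.mul_assoc C _ ((s • 1 - A) * B),
    Matrix.nonsing_inv_mul_cancel_left _ _ hs]

/-- Two realizations of one strictly proper transfer function have the same Markov parameters. -/
theorem markov_parameters_eq {ν' : Type*} [Fintype ν'] [DecidableEq ν']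
    {A₁ : Matrix ν ν ℝ} {B₁ : Matrix ν μ ℝ} {C₁ : Matrix κ ν ℝ}
    {A₂ : Matrix ν' ν' ℝ} {B₂ : Matrix ν' μ ℝ} {C₂ : Matrix κ ν' ℝ}
    (h : ∀ᶠ s : ℝ in atTop, C₁ * (s • (1 : Matrix ν ν ℝ) - A₁)⁻¹ * B₁
      = C₂ * (s • (1 : Matrix ν' ν' ℝ) - A₂)⁻¹ * B₂) (k : ℕ) :
    C₁ * A₁ ^ k * B₁ = C₂ * A₂ ^ k * B₂ := by
  -- The induction carries equality of the shifted transfer functions. The limit of `s` times such a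
  -- function is its leading Markov parameter, which is exactly what the next shift subtracts.
  have key : ∀ k : ℕ, ∀ᶠ s : ℝ in atTop, C₁ * (s • (1 : Matrix ν ν ℝ) - A₁)⁻¹ * (A₁ ^ k * B₁)
      = C₂ * (s • (1 : Matrix ν' ν' ℝ) - A₂)⁻¹ * (A₂ ^ k * B₂) := by
    intro k
    induction k with
    | zero => simpa using h
    | succ k ih =>
      have hlim : C₁ * (A₁ ^ k * B₁) = C₂ * (A₂ ^ k * B₂) :=
        tendsto_nhds_unique
          ((tendsto_smul_mul_resolvent_mul A₁ (A₁ ^ k * B₁) C₁).congr'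
            (ih.mono fun s hs => by rw [hs]))
          (tendsto_smul_mul_resolvent_mul A₂ (A₂ ^ k * B₂) C₂)
      filter_upwards [ih, eventually_isUnit_resolvent A₁, eventually_isUnit_resolvent A₂]
        with s hs h₁ h₂
      rw [pow_succ', pow_succ', Matrix.mul_assoc A₁, Matrix.mul_assoc A₂,
        mul_resolvent_mul_mul _ _ _ h₁, mul_resolvent_mul_mul _ _ _ h₂, hs, hlim]
  rw [Matrix.mul_assoc, Matrix.mul_assoc]
  exact tendsto_nhds_unique
    ((tendsto_smul_mul_resolvent_mul A₁ (A₁ ^ k * B₁) C₁).congr'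
      ((key k).mono fun s hs => by rw [hs]))
    (tendsto_smul_mul_resolvent_mul A₂ (A₂ ^ k * B₂) C₂)

/-! ### Observability, controllability and intertwining of realizations. -/

/-- The pair `(A, C)` is observable: the unobservable subspace is trivial. Controllability of
`(A, B)` is expressed as observability of `(Aᵀ, Bᵀ)`. -/
def IsObservablePair {K : Type*} [Field K] (A : Matrix ν ν K) (C : Matrix κ ν K) : Prop :=
  ∀ v : ν → K, (∀ k : ℕ, (C * A ^ k) *ᵥ v = 0) → v = 0

namespace IsObservablePair

variable {K : Type*} [Field K]

theorem eq_zero_of_mul {A : Matrix ν ν K} {C : Matrix κ ν K} (h : IsObservablePair A C)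
    {α : Type*} {M : Matrix ν α K} (hM : ∀ k : ℕ, C * A ^ k * M = 0) : M = 0 := by
  ext i j
  have := h (M.col j) fun k => by
    have := congrArg (fun Q => Q.col j) (hM k)
    ext i
    simpa [Matrix.mul_apply, Matrix.mulVec, dotProduct] using congrFun this i
  exact congrFun this i

theorem eq_zero_of_mul_transpose {A : Matrix ν ν K} {B : Matrix ν μ K}
    (h : IsObservablePair Aᵀ Bᵀ) {α : Type*} {M : Matrix α ν K}
    (hM : ∀ k : ℕ, M * (A ^ k * B) = 0) : M = 0 := by
  rw [← Matrix.transpose_eq_zero]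
  refine h.eq_zero_of_mul fun k => ?_
  rw [← Matrix.transpose_pow, ← Matrix.transpose_mul, ← Matrix.transpose_mul, hM k,
    Matrix.transpose_zero]

theorem neg {A : Matrix ν ν K} {C : Matrix κ ν K} (h : IsObservablePair A C) :
    IsObservablePair (-A) C := by
  intro v hv
  refine h v fun k => ?_
  have := hv k
  rw [neg_pow] at this
  rcases neg_one_pow_eq_or (Matrix ν ν K) k with hk | hk <;> rw [hk] at this <;>
    simpa [Matrix.neg_mulVec] using this

theorem neg_right {A : Matrix ν ν K} {C : Matrix κ ν K} (h : IsObservablePair A C) :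
    IsObservablePair A (-C) := by
  intro v hv
  refine h v fun k => ?_
  simpa [Matrix.neg_mulVec] using hv k

/-- Observability is invariant under output injection and an injective change of outputs. -/
theorem output_injection [Fintype κ] {A : Matrix ν ν K} {C : Matrix κ ν K} (h : IsObservablePair A C)
    (L : Matrix ν κ K) {κ' : Type*} (U : Matrix κ' κ K)
    (hU : Function.Injective U.mulVec) : IsObservablePair (A + L * C) (U * C) := by
  intro v hv
  have hC : ∀ k : ℕ, (C * (A + L * C) ^ k) *ᵥ v = 0 := fun k => by
    apply hU
    rw [Matrix.mulVec_mulVec, ← Matrix.mul_assoc, hv k, Matrix.mulVec_zero]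
  -- All outputs vanish along the orbit of `v`, so the injected term `L C` never acts and the two
  -- orbits coincide.
  have hp : ∀ k : ℕ, (A + L * C) ^ k *ᵥ v = A ^ k *ᵥ v := by
    intro k
    induction k with
    | zero => simp
    | succ k ih =>
      rw [pow_succ', pow_succ', ← Matrix.mulVec_mulVec, ← Matrix.mulVec_mulVec, Matrix.add_mulVec,
        ih, ← ih, ← Matrix.mulVec_mulVec, Matrix.mulVec_mulVec _ C, hC k, Matrix.mulVec_zero,
        add_zero]
  refine h v fun k => ?_
  rw [← Matrix.mulVec_mulVec, ← hp, Matrix.mulVec_mulVec, hC k]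

/-- A functional vanishing on the span is a row vector annihilating every `A ^ k B`, hence zero. -/
theorem span_eq_top {A : Matrix ν ν K} {B : Matrix ν μ K} (h : IsObservablePair Aᵀ Bᵀ) :
    Submodule.span K (Set.range fun q : ℕ × μ => (A ^ q.1 * B).col q.2) = ⊤ := by
  by_contra hne
  obtain ⟨f, hf0, hf⟩ := Submodule.exists_le_ker_of_lt_top _ (lt_top_iff_ne_top.mpr hne)
  apply hf0
  have hfw : ∀ v, f v = ∑ i, f (Pi.single i 1) * v i := fun v => by
    conv_lhs => rw [← Finset.univ_sum_single v, map_sum]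
    refine Finset.sum_congr rfl fun i _ => ?_
    have : (Pi.single i (v i) : ν → K) = v i • Pi.single i 1 := by
      rw [← Pi.single_smul, smul_eq_mul, mul_one]
    rw [this, map_smul, smul_eq_mul, mul_comm]
  have hM : (Matrix.of fun (_ : Unit) i => f (Pi.single i 1)) = 0 := by
    refine h.eq_zero_of_mul_transpose fun k => ?_
    ext u j
    have := hf (Submodule.subset_span ⟨(k, j), rfl⟩)
    rw [LinearMap.mem_ker, hfw] at this
    simpa [Matrix.mul_apply] using this
  ext i
  simpa using congrFun (congrFun hM ()) i

/-- A controllable realization maps to any observable realization with the same Markov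
parameters. -/
theorem exists_intertwiner {ν' : Type*} [Fintype ν'] [DecidableEq ν']
    {A₁ : Matrix ν ν K} {B₁ : Matrix ν μ K} {C₁ : Matrix κ ν K}
    {A₂ : Matrix ν' ν' K} {B₂ : Matrix ν' μ K} {C₂ : Matrix κ ν' K}
    (hc : IsObservablePair A₁ᵀ B₁ᵀ) (ho : IsObservablePair A₂ C₂)
    (h : ∀ k : ℕ, C₁ * A₁ ^ k * B₁ = C₂ * A₂ ^ k * B₂) :
    ∃ Z : Matrix ν' ν K, Z * A₁ = A₂ * Z ∧ Z * B₁ = B₂ ∧ C₂ * Z = C₁ := by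
  classical
  -- `Γ₁` and `Γ₂` are the reachability maps on finitely supported input sequences. `Z` is to send
  -- `Γ₁ p` to `Γ₂ p`. This is well defined: if `Γ₁ p = 0`, equality of Markov parameters makes all
  -- outputs of `Γ₂ p` vanish, and observability gives `Γ₂ p = 0`.
  let Γ₁ : (ℕ × μ →₀ K) →ₗ[K] ν → K :=
    Finsupp.linearCombination K fun q : ℕ × μ => (A₁ ^ q.1 * B₁).col q.2
  let Γ₂ : (ℕ × μ →₀ K) →ₗ[K] ν' → K :=
    Finsupp.linearCombination K fun q : ℕ × μ => (A₂ ^ q.1 * B₂).col q.2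
  have hsurj : LinearMap.range Γ₁ = ⊤ := by
    rw [Finsupp.range_linearCombination, hc.span_eq_top]
  have hΓ : ∀ (k : ℕ), (Matrix.mulVecLin (C₁ * A₁ ^ k)) ∘ₗ Γ₁
      = (Matrix.mulVecLin (C₂ * A₂ ^ k)) ∘ₗ Γ₂ := by
    intro k
    ext q i
    have h1 := congrFun (congrFun (h (k + q.1)) i) q.2
    rw [pow_add, pow_add] at h1
    have h2 : (C₁ * A₁ ^ k * (A₁ ^ q.1 * B₁)) i q.2 = (C₂ * A₂ ^ k * (A₂ ^ q.1 * B₂)) i q.2 := by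
      simpa only [Matrix.mul_assoc] using h1
    rw [Matrix.mul_apply, Matrix.mul_apply (N := A₂ ^ q.1 * B₂)] at h2
    simpa [Γ₁, Γ₂, -Matrix.mulVecLin_mul, Matrix.mulVec, dotProduct] using h2
  have hker : ∀ p, Γ₁ p = 0 → Γ₂ p = 0 := fun p hp => ho _ fun k => by
    have := LinearMap.congr_fun (hΓ k) p
    simpa [hp] using this.symm
  obtain ⟨g, hg⟩ := Γ₁.exists_rightInverse_of_surjective hsurj
  have hZ : ∀ p, Γ₂ (g (Γ₁ p)) = Γ₂ p := fun p => by
    rw [← sub_eq_zero, ← map_sub]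
    apply hker
    rw [map_sub, sub_eq_zero]
    exact LinearMap.congr_fun hg (Γ₁ p)
  set Z := LinearMap.toMatrix' (Γ₂ ∘ₗ g) with hZdef
  have hZB : ∀ k : ℕ, Z * (A₁ ^ k * B₁) = A₂ ^ k * B₂ := by
    intro k
    ext i j
    have h1 := hZ (Finsupp.single (k, j) 1)
    have h2 : Z *ᵥ (A₁ ^ k * B₁).col j = (A₂ ^ k * B₂).col j := by
      rw [hZdef, LinearMap.toMatrix'_mulVec]
      simpa [Γ₁, Γ₂] using h1
    exact congrFun h2 i
  refine ⟨Z, ?_, by simpa using hZB 0, ?_⟩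
  · rw [← sub_eq_zero]
    refine hc.eq_zero_of_mul_transpose fun k => ?_
    have h1 := hZB (k + 1)
    rw [pow_succ', pow_succ', Matrix.mul_assoc, Matrix.mul_assoc] at h1
    rw [Matrix.sub_mul, Matrix.mul_assoc, h1, Matrix.mul_assoc, hZB, sub_self]
  · rw [← sub_eq_zero]
    refine hc.eq_zero_of_mul_transpose fun k => ?_
    rw [Matrix.sub_mul, Matrix.mul_assoc, hZB, ← Matrix.mul_assoc, ← Matrix.mul_assoc, h, sub_self]

/-- Here `C₁ A₁ ^ k = C₂ A₂ ^ k Z`, so whatever `Z` kills is unobservable. -/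
theorem injective_of_intertwines {ν' : Type*} [Fintype ν'] [DecidableEq ν']
    {A₁ : Matrix ν ν K} {C₁ : Matrix κ ν K} {A₂ : Matrix ν' ν' K} {C₂ : Matrix κ ν' K}
    (ho : IsObservablePair A₁ C₁) {Z : Matrix ν' ν K} (hA : Z * A₁ = A₂ * Z) (hC : C₂ * Z = C₁) :
    Function.Injective Z.mulVec := by
  intro v w hvw
  rw [← sub_eq_zero]
  refine ho _ fun k => ?_
  have hp : Z * A₁ ^ k = A₂ ^ k * Z := by
    induction k with
    | zero => simp
    | succ k ih =>
      rw [pow_succ, ← Matrix.mul_assoc, ih, Matrix.mul_assoc, hA, ← Matrix.mul_assoc, pow_succ]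
  rw [← hC, Matrix.mul_assoc, hp, ← Matrix.mulVec_mulVec, ← Matrix.mulVec_mulVec,
    Matrix.mulVec_sub, hvw, sub_self, Matrix.mulVec_zero, Matrix.mulVec_zero]

end IsObservablePair

end StateSpace

/-! ### All-pass functions with a standard state space realization. -/

section AllPass

open Filter Topology

variable {ν μ : Type*} [Fintype ν] [DecidableEq ν] [Fintype μ] [DecidableEq μ]

/-- State space formula for the inverse of a transfer function with invertible feedthrough. -/
theorem inverse_system_mul {K : Type*} [Field K] {J : Matrix ν ν K} {B : Matrix ν μ K}
    {C : Matrix μ ν K} {D D' : Matrix μ μ K} (hD : D' * D = 1) {s : K}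
    (h₁ : IsUnit (s • (1 : Matrix ν ν K) - J).det)
    (h₂ : IsUnit (s • (1 : Matrix ν ν K) - (J + (-(B * D')) * C)).det) :
    (D' - D' * C * (s • (1 : Matrix ν ν K) - (J + (-(B * D')) * C))⁻¹ * (B * D'))
      * (D + C * (s • (1 : Matrix ν ν K) - J)⁻¹ * B) = 1 := by
  set P := s • (1 : Matrix ν ν K) - J with hP
  set Q := s • (1 : Matrix ν ν K) - (J + (-(B * D')) * C) with hQ
  -- The resolvent identity: the state matrices of the system and of its inverse differ by `B D' C`.
  have h3 : B * D' * C = Q - P := by rw [hQ, hP, Matrix.neg_mul]; abel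
  have h4 : Q⁻¹ * (B * D' * C) * P⁻¹ = P⁻¹ - Q⁻¹ := by
    rw [h3, Matrix.mul_sub, Matrix.nonsing_inv_mul _ h₂, Matrix.sub_mul, Matrix.one_mul,
      Matrix.mul_assoc, Matrix.mul_nonsing_inv _ h₁, Matrix.mul_one]
  have h5 : D' * C * Q⁻¹ * (B * D') * (C * P⁻¹ * B)
      = D' * C * (Q⁻¹ * (B * D' * C) * P⁻¹) * B := by simp only [Matrix.mul_assoc]
  have h6 : D' * C * Q⁻¹ * (B * D') * D = D' * C * Q⁻¹ * B := by
    simp only [Matrix.mul_assoc, hD, Matrix.mul_one]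
  have h7 : D' * (C * P⁻¹ * B) = D' * C * P⁻¹ * B := by simp only [Matrix.mul_assoc]
  rw [Matrix.sub_mul, Matrix.mul_add, Matrix.mul_add, hD, h5, h4, h6, h7, Matrix.mul_sub,
    Matrix.sub_mul]
  abel

/-- A minimal realization of an all-pass transfer function admits mutually inverse (up to scaling)
solutions of the two Lyapunov equations. -/
theorem exists_gramians_of_allPass {J : Matrix ν ν ℝ} {B : Matrix ν μ ℝ} {C : Matrix μ ν ℝ}
    {D : Matrix μ μ ℝ} {ς : ℝ} (hς : ς ≠ 0) (hc : IsObservablePair Jᵀ Bᵀ)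
    (ho : IsObservablePair J C) (hD : D * Dᵀ = ς ^ 2 • (1 : Matrix μ μ ℝ))
    (h : ∀ᶠ s : ℝ in atTop, (D + C * (s • (1 : Matrix ν ν ℝ) - J)⁻¹ * B)
      * (D + C * ((-s) • (1 : Matrix ν ν ℝ) - J)⁻¹ * B)ᵀ = ς ^ 2 • (1 : Matrix μ μ ℝ)) :
    ∃ X Y : Matrix ν ν ℝ, X.IsSymm ∧ Y.IsSymm ∧
      X * Jᵀ + J * X + B * Bᵀ = 0 ∧ Y * J + Jᵀ * Y + Cᵀ * C = 0 ∧
      X * Y = ς ^ 2 • (1 : Matrix ν ν ℝ) ∧ Y * X = ς ^ 2 • (1 : Matrix ν ν ℝ) ∧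
      Dᵀ * C + Bᵀ * Y = 0 ∧ D * Bᵀ + C * X = 0 := by
  have hς2 : ς ^ 2 ≠ 0 := pow_ne_zero 2 hς
  -- `D Dᵀ = ς² I` makes `D'` the inverse of `D`.
  set D' : Matrix μ μ ℝ := (ς ^ 2)⁻¹ • Dᵀ with hD'
  have hDD' : D * D' = 1 := by
    rw [hD', Matrix.mul_smul, hD, smul_smul, inv_mul_cancel₀ hς2, one_smul]
  have hD'D : D' * D = 1 := mul_eq_one_comm.mp hDD'
  have hDt : Dᵀ = ς ^ 2 • D' := by rw [hD', smul_smul, mul_inv_cancel₀ hς2, one_smul]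
  have hco : IsObservablePair (-Jᵀ)ᵀ Cᵀᵀ := by simpa using ho.neg
  have ho' : IsObservablePair (J + (-(B * D')) * C) (-(Dᵀ * C)) := by
    refine (ho.output_injection _ _ ?_).neg_right
    rw [Matrix.mulVec_injective_iff_isUnit]
    refine IsUnit.of_mul_eq_one D'ᵀ ?_
    rw [← Matrix.transpose_mul, hD'D, Matrix.transpose_one]
  -- The two triples realize the strictly proper parts of `G(-s)ᵀ` and of `ς² G(s)⁻¹`. Multiplying
  -- the all-pass identity on the left by the inverse system shows that they agree for large `s`.
  have hmarkov := markov_parameters_eq (A₁ := -Jᵀ) (B₁ := Cᵀ) (C₁ := -Bᵀ)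
    (A₂ := J + (-(B * D')) * C) (B₂ := B * D') (C₂ := -(Dᵀ * C)) (by
      filter_upwards [h, eventually_isUnit_resolvent J,
        eventually_isUnit_resolvent (J + (-(B * D')) * C)] with s hs h₁ h₂
      have hinv := inverse_system_mul (B := B) (C := C) hD'D h₁ h₂
      have h1 := congrArg (fun Q => (D' - D' * C *
        (s • (1 : Matrix ν ν ℝ) - (J + (-(B * D')) * C))⁻¹ * (B * D')) * Q) hs
      simp only [← Matrix.mul_assoc] at h1 hinv
      rw [hinv, Matrix.one_mul, Matrix.mul_smul, Matrix.mul_one, neg_resolvent_neg] at h1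
      have ht : ((s • (1 : Matrix ν ν ℝ) - -J)⁻¹)ᵀ = (s • (1 : Matrix ν ν ℝ) - -Jᵀ)⁻¹ := by
        rw [Matrix.transpose_nonsing_inv]; simp
      simp only [Matrix.transpose_add, Matrix.transpose_mul, Matrix.transpose_neg, ht, hDt,
        smul_sub, Matrix.mul_neg, Matrix.neg_mul] at h1 ⊢
      have h2 := sub_eq_zero.mpr h1
      simp only [Matrix.smul_mul, ← Matrix.mul_assoc] at h2 ⊢
      rw [← sub_eq_zero, ← h2]
      abel)
  obtain ⟨Z, hZA, hZB, hZC⟩ := IsObservablePair.exists_intertwiner hco ho' hmarkov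
  have hZinj := hc.neg.neg_right.injective_of_intertwines hZA hZC
  have hZu := (Matrix.isUnit_iff_isUnit_det _).mp (Matrix.mulVec_injective_iff_isUnit.mp hZinj)
  have hCZ : Dᵀ * C * Z = Bᵀ := by simpa [Matrix.neg_mul] using hZC
  have hCZ' : ς ^ 2 • (C * Z) = D * Bᵀ := by
    rw [← hCZ, Matrix.mul_assoc, ← Matrix.mul_assoc D, hD, Matrix.smul_mul, Matrix.one_mul]
  have hCX : D * Bᵀ + C * (-(ς ^ 2 • Z)) = 0 := by
    rw [Matrix.mul_neg, Matrix.mul_smul, hCZ', add_neg_cancel]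
  have hXC : B * Dᵀ + (-(ς ^ 2 • Z)) * Cᵀ = 0 := by
    rw [Matrix.neg_mul, Matrix.smul_mul, hZB, hDt, Matrix.mul_smul, add_neg_cancel]
  have hLyap : (-(ς ^ 2 • Z)) * Jᵀ + J * (-(ς ^ 2 • Z)) + B * Bᵀ = 0 := by
    have h1 : B * D' * C * (ς ^ 2 • Z) = B * Bᵀ := by
      rw [Matrix.mul_smul, ← hCZ, hDt]
      simp only [Matrix.mul_assoc, Matrix.smul_mul, Matrix.mul_smul]
    rw [Matrix.mul_neg, Matrix.add_mul, Matrix.neg_mul, Matrix.neg_mul] at hZA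
    have h2 := congrArg (fun Q => ς ^ 2 • Q) hZA
    simp only [smul_neg, smul_add, ← Matrix.mul_smul] at h2
    rw [h1] at h2
    rw [Matrix.neg_mul, Matrix.smul_mul, ← Matrix.mul_smul, Matrix.mul_neg, h2]
    abel
  set X : Matrix ν ν ℝ := -(ς ^ 2 • Z) with hX
  have hXs : X.IsSymm := by
    -- Put `Δ = Xᵀ - X`. Comparing the two coupling relations gives `C Δ = 0`, and the Lyapunov
    -- equation minus its transpose gives `J Δ = -Δ Jᵀ`. Powers of `J` can thus be moved past `Δ`,
    -- and observability yields `Δ = 0`.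
    have hd : ∀ k : ℕ, C * J ^ k * (Xᵀ - X) = 0 := by
      have hC0 : C * (Xᵀ - X) = 0 := by
        have := congrArg Matrix.transpose hXC
        simp only [Matrix.transpose_add, Matrix.transpose_mul, Matrix.transpose_transpose,
          Matrix.transpose_zero] at this
        rw [Matrix.mul_sub, sub_eq_zero]
        exact add_left_cancel (this.trans hCX.symm)
      have hJ : J * (Xᵀ - X) = -((Xᵀ - X) * Jᵀ) := by
        have h1 := congrArg Matrix.transpose hLyap
        simp only [Matrix.transpose_add, Matrix.transpose_mul, Matrix.transpose_transpose,
          Matrix.transpose_zero] at h1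
        have h2 := sub_eq_zero.mpr (h1.trans hLyap.symm)
        rw [Matrix.mul_sub, Matrix.sub_mul, ← sub_eq_zero, ← h2]
        abel
      have hk : ∀ k : ℕ, ∃ R : Matrix ν ν ℝ, J ^ k * (Xᵀ - X) = (Xᵀ - X) * R := by
        intro k
        induction k with
        | zero => exact ⟨1, by simp⟩
        | succ k ih =>
          obtain ⟨R, hR⟩ := ih
          exact ⟨-(Jᵀ * R), by
            rw [pow_succ', Matrix.mul_assoc, hR, ← Matrix.mul_assoc, hJ, Matrix.neg_mul,
              Matrix.mul_neg, Matrix.mul_assoc]⟩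
      intro k
      obtain ⟨R, hR⟩ := hk k
      rw [Matrix.mul_assoc, hR, ← Matrix.mul_assoc, hC0, Matrix.zero_mul]
    exact sub_eq_zero.mp (ho.eq_zero_of_mul hd)
  have hXu : IsUnit X.det := by
    have : IsUnit X := by
      rw [hX]
      exact (((Matrix.isUnit_iff_isUnit_det _).mpr hZu).smul (Units.mk0 _ hς2)).neg
    exact (Matrix.isUnit_iff_isUnit_det _).mp this
  have hBY : Dᵀ * C + Bᵀ * (ς ^ 2 • X⁻¹) = 0 := by
    have h1 : Dᵀ * C * X = -(ς ^ 2 • Bᵀ) := by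
      rw [hX, Matrix.mul_neg, Matrix.mul_smul, hCZ]
    have h2 : Dᵀ * C = -(ς ^ 2 • Bᵀ) * X⁻¹ := by
      rw [← h1, Matrix.mul_assoc, Matrix.mul_nonsing_inv _ hXu, Matrix.mul_one]
    rw [h2, Matrix.neg_mul, Matrix.smul_mul, Matrix.mul_smul, neg_add_cancel]
  have hYs : (ς ^ 2 • X⁻¹).IsSymm := by
    rw [Matrix.IsSymm, Matrix.transpose_smul, Matrix.transpose_nonsing_inv, hXs.eq]
  refine ⟨X, ς ^ 2 • X⁻¹, hXs, hYs, hLyap, ?_, ?_, ?_, hBY, hCX⟩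
  -- The dual Lyapunov equation is the first one multiplied by `X⁻¹` on both sides and scaled by
  -- `ς²`. The coupling relation and `D Dᵀ = ς² I` convert `X⁻¹ B Bᵀ X⁻¹` into a multiple of `Cᵀ C`.
  · have h1 : ς ^ 2 • (Cᵀ * C) = (ς ^ 2 • X⁻¹) * B * (Bᵀ * (ς ^ 2 • X⁻¹)) := by
      have h2 : Bᵀ * (ς ^ 2 • X⁻¹) = -(Dᵀ * C) := eq_neg_of_add_eq_zero_right hBY
      have h3 : (ς ^ 2 • X⁻¹) * B = -(Cᵀ * D) := by
        have := congrArg Matrix.transpose h2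
        simpa [Matrix.transpose_mul, Matrix.transpose_nonsing_inv, hXs.eq] using this
      rw [h2, h3, Matrix.neg_mul, Matrix.mul_neg, neg_neg, Matrix.mul_assoc, ← Matrix.mul_assoc D,
        hD, Matrix.smul_mul, Matrix.one_mul, Matrix.mul_smul]
    have h4 := congrArg (fun Q => X⁻¹ * Q * X⁻¹) hLyap
    simp only [Matrix.mul_add, Matrix.add_mul, Matrix.mul_zero, Matrix.zero_mul] at h4
    rw [Matrix.nonsing_inv_mul_cancel_left _ _ hXu, Matrix.mul_assoc _ (J * X), Matrix.mul_assoc J,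
      Matrix.mul_nonsing_inv _ hXu, Matrix.mul_one] at h4
    have h5 : Cᵀ * C = ς ^ 2 • (X⁻¹ * (B * Bᵀ) * X⁻¹) := by
      have : ς ^ 2 • (Cᵀ * C) = ς ^ 2 • (ς ^ 2 • (X⁻¹ * (B * Bᵀ) * X⁻¹)) := by
        rw [h1]
        simp only [Matrix.smul_mul, Matrix.mul_smul, Matrix.mul_assoc]
      exact smul_right_injective _ hς2 this
    rw [h5, Matrix.smul_mul, Matrix.mul_smul, ← smul_add, ← smul_add, ← smul_zero (ς ^ 2), ← h4]
    congr 1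
    abel
  · rw [Matrix.mul_smul, Matrix.mul_nonsing_inv _ hXu]
  · rw [Matrix.smul_mul, Matrix.nonsing_inv_mul _ hXu]

/-- A Gramian satisfying the coupling constraint makes the transfer function all-pass. -/
theorem allPass_of_gramian {K : Type*} [Field K] {J X : Matrix ν ν K} {B : Matrix ν μ K}
    {C : Matrix μ ν K} {D : Matrix μ μ K} {c : K} (hX : X.IsSymm)
    (hL : X * Jᵀ + J * X + B * Bᵀ = 0) (hD : D * Dᵀ = c • (1 : Matrix μ μ K))
    (hCX : D * Bᵀ + C * X = 0) {s : K} (h₁ : IsUnit (s • (1 : Matrix ν ν K) - J).det)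
    (h₂ : IsUnit ((-s) • (1 : Matrix ν ν K) - J).det) :
    (D + C * (s • (1 : Matrix ν ν K) - J)⁻¹ * B)
      * (D + C * ((-s) • (1 : Matrix ν ν K) - J)⁻¹ * B)ᵀ = c • (1 : Matrix μ μ K) := by
  set P := s • (1 : Matrix ν ν K) - J with hP
  set Q := (-s) • (1 : Matrix ν ν K) - J with hQ
  have hQu : IsUnit Qᵀ.det := by rwa [Matrix.det_transpose]
  -- The terms in `s` cancel, leaving the Lyapunov equation. Between `P⁻¹` and `Qᵀ⁻¹` this becomes
  -- `X Qᵀ⁻¹ + P⁻¹ X`, which cancels the two cross terms of the product.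
  have hBB : B * Bᵀ = P * X + X * Qᵀ := by
    have : P * X + X * Qᵀ = -(X * Jᵀ + J * X) := by
      rw [hP, hQ]
      simp only [Matrix.transpose_sub, neg_smul, Matrix.transpose_neg, Matrix.mul_neg,
        Matrix.transpose_smul, Matrix.transpose_one, Matrix.sub_mul,
        Matrix.mul_sub, Matrix.smul_mul, Matrix.mul_smul, Matrix.one_mul, Matrix.mul_one]
      abel
    rw [this]
    exact eq_neg_of_add_eq_zero_right hL
  have hDB : D * Bᵀ = -(C * X) := eq_neg_of_add_eq_zero_left hCX
  have hBD : B * Dᵀ = -(X * Cᵀ) := by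
    have := congrArg Matrix.transpose hDB
    simpa [Matrix.transpose_mul, hX.eq] using this
  have h3 : C * P⁻¹ * B * (Bᵀ * (Qᵀ⁻¹ * Cᵀ)) = C * X * Qᵀ⁻¹ * Cᵀ + C * P⁻¹ * (X * Cᵀ) := by
    have h4 : C * P⁻¹ * B * (Bᵀ * (Qᵀ⁻¹ * Cᵀ)) = C * (P⁻¹ * (B * Bᵀ) * Qᵀ⁻¹) * Cᵀ := by
      simp only [Matrix.mul_assoc]
    rw [h4, hBB, Matrix.mul_add, Matrix.nonsing_inv_mul_cancel_left _ _ h₁, Matrix.add_mul,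
      Matrix.mul_assoc P⁻¹, Matrix.mul_assoc X, Matrix.mul_nonsing_inv _ hQu, Matrix.mul_one]
    simp only [Matrix.mul_add, Matrix.add_mul, Matrix.mul_assoc]
  rw [Matrix.transpose_add, Matrix.transpose_mul, Matrix.transpose_mul,
    Matrix.transpose_nonsing_inv, Matrix.add_mul, Matrix.mul_add, Matrix.mul_add, hD, h3,
    ← Matrix.mul_assoc D, hDB, Matrix.mul_assoc _ B, hBD]
  simp only [Matrix.neg_mul, Matrix.mul_neg, Matrix.mul_assoc]
  abel

end AllPass

/-! ### Finite and infinite parts of a regular pencil. -/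

/-- A Weierstrass form split into its finite part (index `1`) and its infinite part (index `2`):
`T = [T₁, T₂]`, `T⁻¹ = [U₁; U₂]`, `W = [W₁; W₂]` and `W⁻¹ = [V₁, V₂]`. -/
structure DeflatingSplitting {K : Type*} [Field K] {n : ℕ} (E A : Matrix (Fin n) (Fin n) K)
    (nf ni : ℕ) where
  J : Matrix (Fin nf) (Fin nf) K
  N : Matrix (Fin ni) (Fin ni) K
  T₁ : Matrix (Fin n) (Fin nf) K
  T₂ : Matrix (Fin n) (Fin ni) K
  U₁ : Matrix (Fin nf) (Fin n) K
  U₂ : Matrix (Fin ni) (Fin n) K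
  V₁ : Matrix (Fin n) (Fin nf) K
  V₂ : Matrix (Fin n) (Fin ni) K
  W₁ : Matrix (Fin nf) (Fin n) K
  W₂ : Matrix (Fin ni) (Fin n) K
  isNilpotent_N : IsNilpotent N
  U₁_mul_T₁ : U₁ * T₁ = 1
  T_mul_U : T₁ * U₁ + T₂ * U₂ = 1
  W₁_mul_V₁ : W₁ * V₁ = 1
  W₁_mul_V₂ : W₁ * V₂ = 0
  V_mul_W : V₁ * W₁ + V₂ * W₂ = 1
  E_mul_T₁ : E * T₁ = V₁
  E_mul_T₂ : E * T₂ = V₂ * N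
  A_mul_T₁ : A * T₁ = V₁ * J
  A_mul_T₂ : A * T₂ = V₂

namespace WeierstrassForm

variable {K : Type*} [Field K] {n : ℕ} {E A : Matrix (Fin n) (Fin n) K}

theorem mul_T_submatrix (F : WeierstrassForm E A) {M : Matrix (Fin n) (Fin n) K}
    {Q : Matrix (Fin F.nf ⊕ Fin F.ni) (Fin F.nf ⊕ Fin F.ni) K}
    (h : F.W * M * F.T = reindex F.ι F.ι Q) :
    M * F.T.submatrix id F.ι = F.W⁻¹.submatrix id F.ι * Q := by
  have hW := (Matrix.isUnit_iff_isUnit_det _).mp F.isUnit_W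
  have h1 : M * F.T = F.W⁻¹ * reindex F.ι F.ι Q := by
    rw [← h, Matrix.mul_assoc F.W, Matrix.nonsing_inv_mul_cancel_left _ _ hW]
  have h2 := congrArg (fun R => R.submatrix id F.ι) h1
  rw [← Matrix.submatrix_mul_equiv _ _ id (Equiv.refl _) F.ι,
    ← Matrix.submatrix_mul_equiv _ _ id F.ι F.ι] at h2
  simpa using h2

/-- The splitting of a Weierstrass form. -/
noncomputable def splitting (F : WeierstrassForm E A) : DeflatingSplitting E A F.nf F.ni := by
  have hW := (Matrix.isUnit_iff_isUnit_det _).mp F.isUnit_W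
  have hT := (Matrix.isUnit_iff_isUnit_det _).mp F.isUnit_T
  have inv : ∀ {P Q : Matrix (Fin n) (Fin n) K}, P * Q = 1 →
      fromBlocks ((P.submatrix F.ι id).toRows₁ * (Q.submatrix id F.ι).toCols₁)
          ((P.submatrix F.ι id).toRows₁ * (Q.submatrix id F.ι).toCols₂)
          ((P.submatrix F.ι id).toRows₂ * (Q.submatrix id F.ι).toCols₁)
          ((P.submatrix F.ι id).toRows₂ * (Q.submatrix id F.ι).toCols₂)
        = fromBlocks 1 0 0 1 := by
    intro P Q h
    rw [← fromRows_mul_fromCols, fromRows_toRows, fromCols_toCols, fromBlocks_one]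
    have := Matrix.submatrix_mul_equiv P Q F.ι (Equiv.refl _) F.ι
    simpa [h] using this
  have inv' : ∀ {P Q : Matrix (Fin n) (Fin n) K}, P * Q = 1 →
      (P.submatrix id F.ι).toCols₁ * (Q.submatrix F.ι id).toRows₁
        + (P.submatrix id F.ι).toCols₂ * (Q.submatrix F.ι id).toRows₂ = 1 := by
    intro P Q h
    rw [← fromCols_mul_fromRows, fromRows_toRows, fromCols_toCols, Matrix.submatrix_mul_equiv, h]
    simp
  have hE := F.mul_T_submatrix F.E_eq
  have hA := F.mul_T_submatrix F.A_eq
  rw [← fromCols_toCols (F.T.submatrix id F.ι), ← fromCols_toCols (F.W⁻¹.submatrix id F.ι),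
    mul_fromCols, fromCols_mul_fromBlocks] at hE hA
  have hE' := fromCols_inj hE
  have hA' := fromCols_inj hA
  have hUT := fromBlocks_inj.mp (inv (Matrix.nonsing_inv_mul _ hT))
  have hWV := fromBlocks_inj.mp (inv (Matrix.mul_nonsing_inv _ hW))
  simp only [Matrix.mul_zero, Matrix.mul_one, add_zero, zero_add] at hE' hA'
  exact
  { J := F.J
    N := F.N
    T₁ := (F.T.submatrix id F.ι).toCols₁
    T₂ := (F.T.submatrix id F.ι).toCols₂
    U₁ := (F.T⁻¹.submatrix F.ι id).toRows₁
    U₂ := (F.T⁻¹.submatrix F.ι id).toRows₂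
    V₁ := (F.W⁻¹.submatrix id F.ι).toCols₁
    V₂ := (F.W⁻¹.submatrix id F.ι).toCols₂
    W₁ := (F.W.submatrix F.ι id).toRows₁
    W₂ := (F.W.submatrix F.ι id).toRows₂
    isNilpotent_N := F.isNilpotent_N
    U₁_mul_T₁ := hUT.1
    T_mul_U := inv' (Matrix.mul_nonsing_inv _ hT)
    W₁_mul_V₁ := hWV.1
    W₁_mul_V₂ := hWV.2.1
    V_mul_W := inv' (Matrix.nonsing_inv_mul _ hW)
    E_mul_T₁ := hE'.1
    E_mul_T₂ := hE'.2
    A_mul_T₁ := hA'.1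
    A_mul_T₂ := hA'.2 }

theorem mul_reindex_mul (F : WeierstrassForm E A) (P Q : Matrix (Fin n) (Fin n) K) :
    P * reindex F.ι F.ι (fromBlocks 1 0 0 0) * Q
      = (P.submatrix id F.ι).toCols₁ * (Q.submatrix F.ι id).toRows₁ := by
  have h1 : P * reindex F.ι F.ι (fromBlocks 1 0 0 0) * Q
      = P.submatrix id F.ι
        * (fromBlocks 1 0 0 0 : Matrix (Fin F.nf ⊕ Fin F.ni) (Fin F.nf ⊕ Fin F.ni) K)
        * Q.submatrix F.ι id := by
    have h2 := Matrix.submatrix_mul_equiv P (reindex F.ι F.ι (fromBlocks 1 0 0 0)) id F.ι F.ι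
    have h3 := Matrix.submatrix_mul_equiv (P * reindex F.ι F.ι (fromBlocks 1 0 0 0)) Q id F.ι id
    rw [← h2] at h3
    simpa using h3.symm
  rw [h1]
  conv_lhs => rw [← fromCols_toCols (P.submatrix id F.ι), ← fromRows_toRows (Q.submatrix F.ι id)]
  rw [fromCols_mul_fromBlocks, fromCols_mul_fromRows]
  simp

theorem left_eq (F : WeierstrassForm E A) : F.left = F.splitting.V₁ * F.splitting.W₁ :=
  F.mul_reindex_mul _ _

theorem right_eq (F : WeierstrassForm E A) : F.right = F.splitting.T₁ * F.splitting.U₁ :=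
  F.mul_reindex_mul _ _

end WeierstrassForm

namespace DeflatingSplitting

variable {K : Type*} [Field K] {n nf ni : ℕ} {E A : Matrix (Fin n) (Fin n) K}

/-- Extension of scalars. -/
def map {L : Type*} [Field L] (f : K →+* L) (F : DeflatingSplitting E A nf ni) :
    DeflatingSplitting (E.map f) (A.map f) nf ni where
  J := F.J.map f
  N := F.N.map f
  T₁ := F.T₁.map f
  T₂ := F.T₂.map f
  U₁ := F.U₁.map f
  U₂ := F.U₂.map f
  V₁ := F.V₁.map f
  V₂ := F.V₂.map f
  W₁ := F.W₁.map f
  W₂ := F.W₂.map f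
  isNilpotent_N := F.isNilpotent_N.map f.mapMatrix
  U₁_mul_T₁ := by rw [← Matrix.map_mul, F.U₁_mul_T₁]; simp
  T_mul_U := by
    rw [← Matrix.map_mul, ← Matrix.map_mul, ← Matrix.map_add f (map_add f), F.T_mul_U]; simp
  W₁_mul_V₁ := by rw [← Matrix.map_mul, F.W₁_mul_V₁]; simp
  W₁_mul_V₂ := by rw [← Matrix.map_mul, F.W₁_mul_V₂]; simp
  V_mul_W := by
    rw [← Matrix.map_mul, ← Matrix.map_mul, ← Matrix.map_add f (map_add f), F.V_mul_W]; simp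
  E_mul_T₁ := by rw [← Matrix.map_mul, F.E_mul_T₁]
  E_mul_T₂ := by rw [← Matrix.map_mul, ← Matrix.map_mul, F.E_mul_T₂]
  A_mul_T₁ := by rw [← Matrix.map_mul, ← Matrix.map_mul, F.A_mul_T₁]
  A_mul_T₂ := by rw [← Matrix.map_mul, F.A_mul_T₂]

variable (F : DeflatingSplitting E A nf ni)

/-- Insert `1 = T₁ U₁ + T₂ U₂` on the right: `E T₁ = V₁` survives, while `E T₂` lies in the range of
`V₂`, which `W₁` annihilates. -/
theorem W₁_mul_E : F.W₁ * E = F.U₁ := by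
  have h : F.W₁ * E * (F.T₁ * F.U₁ + F.T₂ * F.U₂)
      = F.W₁ * (E * F.T₁) * F.U₁ + F.W₁ * (E * F.T₂) * F.U₂ := by
    simp only [Matrix.mul_add, Matrix.mul_assoc]
  rw [F.T_mul_U, Matrix.mul_one, F.E_mul_T₁, F.E_mul_T₂, F.W₁_mul_V₁, ← Matrix.mul_assoc,
    F.W₁_mul_V₂, Matrix.one_mul, Matrix.zero_mul, Matrix.zero_mul, add_zero] at h
  exact h

theorem W₁_mul_A : F.W₁ * A = F.J * F.U₁ := by
  have h : F.W₁ * A * (F.T₁ * F.U₁ + F.T₂ * F.U₂)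
      = F.W₁ * (A * F.T₁) * F.U₁ + F.W₁ * (A * F.T₂) * F.U₂ := by
    simp only [Matrix.mul_add, Matrix.mul_assoc]
  rw [F.T_mul_U, Matrix.mul_one, F.A_mul_T₁, F.A_mul_T₂, ← Matrix.mul_assoc F.W₁, F.W₁_mul_V₁,
    F.W₁_mul_V₂, Matrix.one_mul, Matrix.zero_mul, add_zero] at h
  exact h

theorem W₁_mul_pencil (z : K) :
    F.W₁ * (z • E - A) = (z • (1 : Matrix (Fin nf) (Fin nf) K) - F.J) * F.U₁ := by
  rw [Matrix.mul_sub, Matrix.mul_smul, F.W₁_mul_E, F.W₁_mul_A, Matrix.sub_mul, Matrix.smul_mul,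
    Matrix.one_mul]

theorem pencil_mul_T₁ (z : K) :
    (z • E - A) * F.T₁ = F.V₁ * (z • (1 : Matrix (Fin nf) (Fin nf) K) - F.J) := by
  rw [Matrix.sub_mul, Matrix.smul_mul, F.E_mul_T₁, F.A_mul_T₁, Matrix.mul_sub, Matrix.mul_smul,
    Matrix.mul_one]

theorem isUnit_det_finite {z : K} (h : IsUnit (z • E - A).det) :
    IsUnit (z • (1 : Matrix (Fin nf) (Fin nf) K) - F.J).det := by
  rw [← Matrix.isUnit_iff_isUnit_det]
  -- The inverse of the finite block is the compression of the inverse pencil.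
  refine IsUnit.of_mul_eq_one (F.U₁ * (z • E - A)⁻¹ * F.V₁) ?_
  rw [← Matrix.mul_assoc, ← Matrix.mul_assoc, ← F.W₁_mul_pencil, Matrix.mul_assoc F.W₁,
    Matrix.mul_nonsing_inv _ h, Matrix.mul_one, F.W₁_mul_V₁]

/-- The pencil is block diagonal up to invertible factors. Its infinite block `z N - 1` is inverted
by minus the Neumann series, which is finite because `N` is nilpotent. -/
theorem pencil_mul_inverse {z : K} {l : ℕ} (hl : F.N ^ l = 0)
    (h : IsUnit (z • (1 : Matrix (Fin nf) (Fin nf) K) - F.J).det) :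
    (z • E - A) * (F.T₁ * (z • (1 : Matrix (Fin nf) (Fin nf) K) - F.J)⁻¹ * F.W₁
      - F.T₂ * (∑ k ∈ Finset.range l, (z • F.N) ^ k) * F.W₂) = 1 := by
  have h1 : (z • E - A) * F.T₂ = -(F.V₂ * (1 - z • F.N)) := by
    rw [Matrix.sub_mul, Matrix.smul_mul, F.E_mul_T₂, F.A_mul_T₂, Matrix.mul_sub, Matrix.mul_smul,
      Matrix.mul_one, neg_sub]
  have h2 : (1 - z • F.N) * ∑ k ∈ Finset.range l, (z • F.N) ^ k = 1 := by
    rw [mul_neg_geom_sum, _root_.smul_pow, hl, smul_zero, sub_zero]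
  rw [Matrix.mul_sub, ← Matrix.mul_assoc, ← Matrix.mul_assoc, ← Matrix.mul_assoc,
    ← Matrix.mul_assoc, F.pencil_mul_T₁, h1, Matrix.mul_assoc F.V₁, Matrix.mul_nonsing_inv _ h,
    Matrix.mul_one, Matrix.neg_mul, Matrix.mul_assoc F.V₂, h2, Matrix.mul_one, Matrix.neg_mul,
    sub_neg_eq_add, F.V_mul_W]

theorem inv_pencil {z : K} {l : ℕ} (hl : F.N ^ l = 0)
    (h : IsUnit (z • (1 : Matrix (Fin nf) (Fin nf) K) - F.J).det) :
    (z • E - A)⁻¹ = F.T₁ * (z • (1 : Matrix (Fin nf) (Fin nf) K) - F.J)⁻¹ * F.W₁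
      - F.T₂ * (∑ k ∈ Finset.range l, (z • F.N) ^ k) * F.W₂ :=
  Matrix.inv_eq_right_inv (F.pencil_mul_inverse hl h)

theorem isUnit_det_pencil {z : K}
    (h : IsUnit (z • (1 : Matrix (Fin nf) (Fin nf) K) - F.J).det) : IsUnit (z • E - A).det := by
  obtain ⟨l, hl⟩ := F.isNilpotent_N
  rw [← Matrix.isUnit_iff_isUnit_det]
  exact IsUnit.of_mul_eq_one _ (F.pencil_mul_inverse hl h)

end DeflatingSplitting

/-! ### Polynomial parts of rational functions. -/

/-- Uniqueness of the polynomial part. Two decompositions would make a nonzero polynomial times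
`denom * b` equal to something of degree smaller than that of `denom * b`. -/
theorem RatFunc.num_div_denom_eq_of_add {K : Type*} [Field K] {f : RatFunc K} {q a b : K[X]}
    (hab : a.degree < b.degree)
    (hf : f = algebraMap K[X] (RatFunc K) q
      + algebraMap K[X] (RatFunc K) a / algebraMap K[X] (RatFunc K) b) :
    f.num / f.denom = q := by
  have hb : b ≠ 0 := by rintro rfl; simp at hab
  have hb' : algebraMap K[X] (RatFunc K) b ≠ 0 := RatFunc.algebraMap_ne_zero hb
  have hd : f.denom ≠ 0 := f.denom_ne_zero
  have hf' : f = algebraMap K[X] (RatFunc K) (q * b + a) / algebraMap K[X] (RatFunc K) b := by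
    rw [hf, map_add, map_mul, add_div, mul_div_cancel_right₀ _ hb']
  have hcross : f.num * b = (q * b + a) * f.denom :=
    (RatFunc.num_mul_eq_mul_denom_iff hb).mpr hf'
  have hdm := EuclideanDomain.div_add_mod f.num f.denom
  have hlt : (f.num % f.denom).degree < f.denom.degree := EuclideanDomain.mod_lt _ hd
  have hkey : (f.num / f.denom - q) * (f.denom * b) = a * f.denom - (f.num % f.denom) * b := by
    linear_combination hcross + b * hdm
  by_contra hne
  have hne' : f.num / f.denom - q ≠ 0 := sub_ne_zero.mpr hne
  have h1 : (a * f.denom - (f.num % f.denom) * b).degree < (f.denom * b).degree := by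
    refine (degree_sub_le _ _).trans_lt (max_lt ?_ ?_)
    · rw [degree_mul, degree_mul, add_comm]
      exact WithBot.add_lt_add_left (degree_ne_bot.mpr hd) hab
    · rw [degree_mul, degree_mul]
      exact WithBot.add_lt_add_right (degree_ne_bot.mpr hb) hlt
  rw [← hkey, degree_mul] at h1
  have h2 : 0 ≤ (f.num / f.denom - q).degree := zero_le_degree_iff.mpr hne'
  exact absurd h1 (not_lt.mpr (le_add_of_nonneg_left h2))

/-- Viewed as a polynomial `q` with matrix coefficients, the adjugate satisfies `(X - J) q =
charpoly`. The factor `X - J` is monic of degree one, so a nonzero `q` has degree one less than the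
bound for the right side. This makes the resolvent strictly proper. -/
theorem degree_adjugate_charmatrix_lt {R ν : Type*} [Field R] [Fintype ν] [DecidableEq ν]
    (J : Matrix ν ν R) (i j : ν) : (J.charmatrix.adjugate i j).degree < J.charpoly.degree := by
  have : Nonempty ν := ⟨i⟩
  set q := matPolyEquiv J.charmatrix.adjugate with hq
  have h1 : (X - C J) * q = J.charpoly.map (algebraMap R (Matrix ν ν R)) := by
    rw [hq, ← matPolyEquiv_charmatrix, ← map_mul, Matrix.mul_adjugate]
    exact matPolyEquiv_smul_one _
  rw [J.charpoly_degree_eq_dim]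
  by_cases h0 : q = 0
  · have : J.charmatrix.adjugate = 0 := by simpa [hq] using h0
    rw [this]
    simp
  have h2 := (monic_X_sub_C J).natDegree_mul' h0
  rw [h1, natDegree_X_sub_C] at h2
  have h3 : (J.charpoly.map (algebraMap R (Matrix ν ν R))).natDegree ≤ Fintype.card ν :=
    natDegree_map_le.trans J.charpoly_natDegree_eq_dim.le
  rw [Polynomial.degree_lt_iff_coeff_zero]
  intro k hk
  have h4 := matPolyEquiv_coeff_apply J.charmatrix.adjugate k i j
  rw [← h4, ← hq, coeff_eq_zero_of_natDegree_lt (by omega)]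
  rfl

/-! ### Growth of all-pass functions and the eigenvector test for observability. -/

section

open Filter Topology

theorem tendsto_inv_pow_smul_polynomial {μ κ : Type*} {F : ℝ → Matrix μ κ ℝ}
    (hF : Tendsto F atTop (𝓝 0)) (M : ℕ → Matrix μ κ ℝ) (l : ℕ) :
    Tendsto (fun s : ℝ => (s ^ l)⁻¹ • (F s + ∑ k ∈ Finset.range (l + 1), s ^ k • M k)) atTop
      (𝓝 (M l)) := by
  have hlow : Tendsto (fun s : ℝ => (s ^ l)⁻¹ • ∑ k ∈ Finset.range l, s ^ k • M k) atTop (𝓝 0) := by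
    simp only [Finset.smul_sum, smul_smul]
    rw [← Finset.sum_const_zero (s := Finset.range l)]
    refine tendsto_finsetSum _ fun k hk => ?_
    have hk' := Finset.mem_range.mp hk
    have h1 : Tendsto (fun s : ℝ => (s ^ (l - k))⁻¹) atTop (𝓝 0) :=
      (tendsto_pow_atTop (by omega)).inv_tendsto_atTop
    have h2 := h1.smul_const (M k)
    rw [zero_smul] at h2
    refine h2.congr' ?_
    filter_upwards [eventually_gt_atTop 0] with s hs
    congr 1
    rw [inv_eq_iff_eq_inv, mul_inv, inv_inv, pow_sub₀ _ hs.ne' hk'.le]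
  have hFl : Tendsto (fun s : ℝ => (s ^ l)⁻¹ • F s) atTop (𝓝 0) := by
    rcases Nat.eq_zero_or_pos l with rfl | hl
    · simpa using hF
    · have h1 : Tendsto (fun s : ℝ => (s ^ l)⁻¹) atTop (𝓝 0) :=
        (tendsto_pow_atTop hl.ne').inv_tendsto_atTop
      simpa using h1.smul hF
  have h := (hFl.add hlow).add (tendsto_const_nhds (x := M l))
  rw [add_zero, zero_add] at h
  refine h.congr' ?_
  filter_upwards [eventually_gt_atTop 0] with s hs
  rw [Finset.sum_range_succ, smul_add, smul_add, smul_smul, inv_mul_cancel₀ (pow_ne_zero l hs.ne'),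
    one_smul, add_assoc]

/-- The polynomial part of a real all-pass function is constant. -/
theorem polynomial_coeff_eq_zero_of_allPass {μ : Type*} [Fintype μ] {F G : ℝ → Matrix μ μ ℝ}
    (hF : Tendsto F atTop (𝓝 0)) (hG : Tendsto G atTop (𝓝 0)) (M : ℕ → Matrix μ μ ℝ)
    {Q : Matrix μ μ ℝ} (l : ℕ)
    (h : ∀ᶠ s : ℝ in atTop, (F s + ∑ k ∈ Finset.range l, s ^ k • M k)
      * (G s + ∑ k ∈ Finset.range l, (-s) ^ k • M k)ᵀ = Q) {k : ℕ} (hk : 1 ≤ k) (hkl : k < l) :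
    M k = 0 := by
  induction l with
  | zero => omega
  | succ l ih =>
    rcases Nat.eq_zero_or_pos l with rfl | hl
    · omega
    have hMl : M l = 0 := by
      have h1 := tendsto_inv_pow_smul_polynomial hF M l
      -- The signs of `(-s) ^ k` are absorbed into the coefficients, so that both factors can be
      -- divided by the same `s ^ l`.
      have h2 := tendsto_inv_pow_smul_polynomial hG (fun k => (-1 : ℝ) ^ k • M k) l
      have h3 := ((continuous_fst.matrix_mul continuous_snd.matrix_transpose).tendsto
        (M l, (-1 : ℝ) ^ l • M l)).comp (h1.prodMk_nhds h2)
      have h4 : Tendsto (fun s : ℝ => (s ^ l)⁻¹ • (s ^ l)⁻¹ • Q) atTop (𝓝 0) := by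
        have h5 : Tendsto (fun s : ℝ => (s ^ l)⁻¹) atTop (𝓝 0) :=
          (tendsto_pow_atTop hl.ne').inv_tendsto_atTop
        simpa using h5.smul (h5.smul_const Q)
      have h6 : M l * ((-1 : ℝ) ^ l • M l)ᵀ = 0 := by
        refine tendsto_nhds_unique h3 (h4.congr' ?_)
        filter_upwards [h] with s hs
        have h7 : ∀ k : ℕ, s ^ k • (-1 : ℝ) ^ k • M k = (-s) ^ k • M k := fun k => by
          rw [smul_smul, ← mul_pow, mul_neg_one]
        simp only [Function.comp, h7, Matrix.transpose_smul, Matrix.smul_mul, Matrix.mul_smul, hs]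
      -- Over the reals the transpose is the conjugate transpose, so the vanishing Gram matrix kills
      -- `M l`.
      have h8 : M l * (M l)ᴴ = 0 := by
        rw [Matrix.transpose_smul, Matrix.mul_smul] at h6
        rw [Matrix.conjTranspose_eq_transpose_of_trivial]
        exact (smul_eq_zero.mp h6).resolve_left (pow_ne_zero _ (by norm_num))
      exact Matrix.self_mul_conjTranspose_eq_zero.mp h8
    rcases Nat.lt_succ_iff_lt_or_eq.mp hkl with hlt | rfl
    · refine ih ?_ hlt
      simpa [Finset.sum_range_succ, hMl] using h
    · exact hMl

/-- The Popov-Belevitch-Hautus test. -/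
theorem isObservablePair_of_eigenvectors {ν κ : Type*} [Fintype ν] [DecidableEq ν]
    {J : Matrix ν ν ℝ} {C : Matrix κ ν ℝ}
    (h : ∀ (z : ℂ) (v : ν → ℂ), J.map (algebraMap ℝ ℂ) *ᵥ v = z • v →
      C.map (algebraMap ℝ ℂ) *ᵥ v = 0 → v = 0) : IsObservablePair J C := by
  intro w hw
  set J' := J.map (algebraMap ℝ ℂ) with hJ'
  set C' := C.map (algebraMap ℝ ℂ) with hC'
  -- The complexified unobservable subspace is invariant under `J'`; if nonzero it would contain an
  -- eigenvector of `J'`, which `C'` annihilates.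
  let U : Submodule ℂ (ν → ℂ) := ⨅ k : ℕ, LinearMap.ker (Matrix.mulVecLin (C' * J' ^ k))
  have hU : ∀ v, v ∈ U ↔ ∀ k : ℕ, (C' * J' ^ k) *ᵥ v = 0 := fun v => by
    simp only [U, Submodule.mem_iInf, LinearMap.mem_ker, Matrix.mulVecLin_apply]
  have hinv : ∀ v ∈ U, Matrix.mulVecLin J' v ∈ U := fun v hv => by
    rw [hU] at hv ⊢
    intro k
    rw [Matrix.mulVecLin_apply, Matrix.mulVec_mulVec, Matrix.mul_assoc, ← pow_succ]
    exact hv (k + 1)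
  have hbot : U = ⊥ := by
    by_contra hne
    have : Nontrivial U := Submodule.nontrivial_iff_ne_bot.mpr hne
    obtain ⟨z, hz⟩ := Module.End.exists_eigenvalue ((Matrix.mulVecLin J').restrict hinv)
    obtain ⟨v, hv⟩ := hz.exists_hasEigenvector
    have h1 : J' *ᵥ (v : ν → ℂ) = z • (v : ν → ℂ) := congrArg Subtype.val hv.apply_eq_smul
    have h2 : C' *ᵥ (v : ν → ℂ) = 0 := by simpa using (hU v).mp v.2 0
    exact hv.2 (Subtype.ext (h z v h1 h2))
  have hw' : (algebraMap ℝ ℂ ∘ w) ∈ U := by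
    rw [hU]
    intro k
    have h1 : C' * J' ^ k = (C * J ^ k).map (algebraMap ℝ ℂ) := by
      rw [Matrix.map_mul, Matrix.map_pow]
    ext i
    rw [h1, ← RingHom.map_mulVec, hw k]
    simp
  rw [hbot, Submodule.mem_bot] at hw'
  ext i
  simpa using congrFun hw' i

end

theorem eq_zero_of_mulVec_eq_zero_of_rank {K α : Type*} [Field K] [Finite α] {n : ℕ}
    {M : Matrix α (Fin n) K} (hM : M.rank = n) {v : Fin n → K} (hv : M *ᵥ v = 0) : v = 0 := by
  have h := M.mulVecLin.finrank_range_add_finrank_ker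
  rw [← Matrix.rank, hM, Module.finrank_fin_fun, Nat.add_eq_left, Submodule.finrank_eq_zero] at h
  have hv' : v ∈ LinearMap.ker M.mulVecLin := by simpa using hv
  rwa [h, Submodule.mem_bot] at hv'

theorem map_nonsing_inv_of_field {K L ν : Type*} [Field K] [Field L] [Fintype ν] [DecidableEq ν]
    (f : K →+* L) (M : Matrix ν ν K) : (M.map f)⁻¹ = M⁻¹.map f := by
  have hdet : (M.map f).det = f M.det := (f.map_det M).symm
  have hadj : (M.map f).adjugate = M.adjugate.map f := (f.map_adjugate M).symm
  rw [Matrix.inv_def, Matrix.inv_def, hdet, hadj, Ring.inverse_eq_inv', Ring.inverse_eq_inv',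
    ← map_inv₀]
  ext i j
  simp

/-! ### The transfer function in Weierstrass coordinates. -/

namespace DescriptorSystem

variable {n m p nf ni : ℕ} (S : DescriptorSystem n m p) (F : DeflatingSplitting S.E S.A nf ni)

/-- The coefficients of the polynomial part of the transfer function, read off from a
Weierstrass form. -/
def infiniteCoeff (k : ℕ) : Matrix (Fin p) (Fin m) ℝ :=
  (if k = 0 then S.D else 0) - S.C * F.T₂ * F.N ^ k * F.W₂ * S.B

theorem transfer_eq {K : Type*} [Field K] [Algebra ℝ K] {z : K} {l : ℕ} (hl : F.N ^ l = 0)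
    (hl0 : 0 < l)
    (h : IsUnit (z • (1 : Matrix (Fin nf) (Fin nf) K) - F.J.map (algebraMap ℝ K)).det) :
    S.transfer z = (S.C * F.T₁).map (algebraMap ℝ K)
        * (z • (1 : Matrix (Fin nf) (Fin nf) K) - F.J.map (algebraMap ℝ K))⁻¹
        * (F.W₁ * S.B).map (algebraMap ℝ K)
      + ∑ k ∈ Finset.range l, z ^ k • (S.infiniteCoeff F k).map (algebraMap ℝ K) := by
  have hl' : (F.map (algebraMap ℝ K)).N ^ l = 0 := by
    change F.N.map (algebraMap ℝ K) ^ l = 0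
    rw [← Matrix.map_pow, hl]; simp
  have h1 := (F.map (algebraMap ℝ K)).inv_pencil hl' h
  have h2 : ∑ k ∈ Finset.range l, z ^ k • (S.infiniteCoeff F k).map (algebraMap ℝ K)
      = S.D.map (algebraMap ℝ K) - S.C.map (algebraMap ℝ K) * (F.T₂.map (algebraMap ℝ K)
        * (∑ k ∈ Finset.range l, (z • F.N.map (algebraMap ℝ K)) ^ k) * F.W₂.map (algebraMap ℝ K))
        * S.B.map (algebraMap ℝ K) := by
    have h3 : ∀ k : ℕ, z ^ k • (S.infiniteCoeff F k).map (algebraMap ℝ K)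
        = (if k = 0 then S.D.map (algebraMap ℝ K) else 0)
          - S.C.map (algebraMap ℝ K) * (F.T₂.map (algebraMap ℝ K)
            * (z • F.N.map (algebraMap ℝ K)) ^ k * F.W₂.map (algebraMap ℝ K))
            * S.B.map (algebraMap ℝ K) := by
      intro k
      rw [infiniteCoeff, Matrix.map_sub _ (map_sub _), smul_sub, _root_.smul_pow]
      simp only [Matrix.map_mul, Matrix.map_pow, Matrix.mul_smul, Matrix.smul_mul, Matrix.mul_assoc]
      split_ifs with hk
      · simp [hk]
      · simp
    rw [Finset.sum_congr rfl fun k _ => h3 k, Finset.sum_sub_distrib, Finset.sum_ite_eq',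
      if_pos (Finset.mem_range.mpr hl0)]
    simp only [Matrix.mul_sum, Matrix.sum_mul]
  rw [h2, transfer, matrixPencil, h1]
  simp only [DeflatingSplitting.map, Matrix.map_mul, Matrix.mul_sub, Matrix.sub_mul,
    Matrix.mul_assoc]
  abel

/-- At the indeterminate, the resolvent of `J` is its adjugate over the characteristic polynomial,
hence strictly proper. By uniqueness, the remaining sum is the polynomial part, so its coefficients
can be read off from any splitting. -/
theorem polynomialCoeff_eq (k : ℕ) : S.polynomialCoeff k = S.infiniteCoeff F k := by
  -- The exponent is taken positive so that the sum contains the term `k = 0`, which carries `D`,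
  -- even if the infinite block is empty.
  obtain ⟨l, hl⟩ : ∃ l, F.N ^ (l + 1) = 0 := by
    obtain ⟨l, hl⟩ := F.isNilpotent_N
    exact ⟨l, by rw [pow_succ, hl, zero_mul]⟩
  have hP : (RatFunc.X : RatFunc ℝ) • (1 : Matrix (Fin nf) (Fin nf) (RatFunc ℝ))
      - F.J.map (algebraMap ℝ (RatFunc ℝ)) = F.J.charmatrix.map (algebraMap ℝ[X] (RatFunc ℝ)) := by
    ext i j
    rcases eq_or_ne i j with rfl | hij
    · simp [charmatrix_apply_eq]
    · simp [hij]
  have hdet : (F.J.charmatrix.map (algebraMap ℝ[X] (RatFunc ℝ))).det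
      = algebraMap ℝ[X] (RatFunc ℝ) F.J.charpoly := by
    rw [Matrix.charpoly, RingHom.map_det]; rfl
  have hne : algebraMap ℝ[X] (RatFunc ℝ) F.J.charpoly ≠ 0 :=
    RatFunc.algebraMap_ne_zero F.J.charpoly_monic.ne_zero
  have htr := S.transfer_eq F (z := (RatFunc.X : RatFunc ℝ)) hl l.succ_pos
    (by rw [hP, hdet]; exact isUnit_iff_ne_zero.mpr hne)
  have hinv : (F.J.charmatrix.map (algebraMap ℝ[X] (RatFunc ℝ)))⁻¹
      = (algebraMap ℝ[X] (RatFunc ℝ) F.J.charpoly)⁻¹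
        • F.J.charmatrix.adjugate.map (algebraMap ℝ[X] (RatFunc ℝ)) := by
    rw [Matrix.inv_def, hdet, Ring.inverse_eq_inv']
    congr 1
    exact (RingHom.map_adjugate (algebraMap ℝ[X] (RatFunc ℝ)) F.J.charmatrix).symm
  have hcomp : ∀ {a b : ℕ} (M : Matrix (Fin a) (Fin b) ℝ), M.map (algebraMap ℝ (RatFunc ℝ))
      = (M.map (Polynomial.C : ℝ →+* ℝ[X])).map (algebraMap ℝ[X] (RatFunc ℝ)) := by
    intro a b M
    ext i j
    simp
  set R : Matrix (Fin p) (Fin m) ℝ[X] := (S.C * F.T₁).map (Polynomial.C : ℝ →+* ℝ[X])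
    * F.J.charmatrix.adjugate * (F.W₁ * S.B).map (Polynomial.C : ℝ →+* ℝ[X]) with hR
  have hRdeg : ∀ i j, (R i j).degree < F.J.charpoly.degree := by
    intro i j
    have hbot : ⊥ < F.J.charpoly.degree :=
      bot_lt_iff_ne_bot.mpr (degree_ne_bot.mpr F.J.charpoly_monic.ne_zero)
    have hsum : ∀ (f : Fin nf → ℝ[X]), (∀ a, (f a).degree < F.J.charpoly.degree) →
        (∑ a, f a).degree < F.J.charpoly.degree := fun f hf =>
      (degree_sum_le _ _).trans_lt ((Finset.sup_lt_iff hbot).mpr fun a _ => hf a)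
    rw [hR, Matrix.mul_apply]
    refine hsum _ fun a => ?_
    rw [Matrix.map_apply, mul_comm, ← smul_eq_C_mul]
    refine (degree_smul_le _ _).trans_lt ?_
    rw [Matrix.mul_apply]
    refine hsum _ fun b => ?_
    rw [Matrix.map_apply, ← smul_eq_C_mul]
    exact (degree_smul_le _ _).trans_lt (degree_adjugate_charmatrix_lt _ _ _)
  have hpart : ∀ i j, S.polynomialPart i j
      = ∑ k ∈ Finset.range (l + 1), X ^ k * Polynomial.C (S.infiniteCoeff F k i j) := by
    intro i j
    refine RatFunc.num_div_denom_eq_of_add (hRdeg i j) ?_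
    rw [htr, hP, hinv, hcomp, hcomp, Matrix.mul_smul, Matrix.smul_mul, ← Matrix.map_mul,
      ← Matrix.map_mul, ← hR, Matrix.add_apply, add_comm]
    congr 1
    · rw [Matrix.sum_apply, map_sum]
      refine Finset.sum_congr rfl fun k _ => ?_
      simp only [Matrix.smul_apply, Matrix.map_apply, smul_eq_mul, map_mul, map_pow,
        RatFunc.algebraMap_X, IsScalarTower.algebraMap_apply ℝ ℝ[X] (RatFunc ℝ),
        Polynomial.algebraMap_eq]
    · simp [div_eq_inv_mul]
  ext i j
  rw [polynomialCoeff, Matrix.map_apply, hpart, finsetSum_coeff]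
  simp only [coeff_X_pow_mul', coeff_C]
  by_cases hk : k < l + 1
  · rw [Finset.sum_eq_single k]
    · simp
    · intro b _ hb
      split_ifs with h1 h2
      · omega
      · rfl
      · rfl
    · intro h; exact absurd (Finset.mem_range.mpr hk) h
  · rw [Finset.sum_eq_zero]
    · have h1 : F.N ^ k = 0 := pow_eq_zero_of_le (by omega) hl
      simp [infiniteCoeff, h1, show k ≠ 0 by omega]
    · intro b hb
      have := Finset.mem_range.mp hb
      split_ifs with h1 h2
      · omega
      · rfl
      · rfl

/-- If `J v = z v` and `C T₁ v = 0`, then `T₁ v` lies in the kernel of `[z E - A; C]`, so it is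
zero; `U₁ T₁ = 1` recovers `v = 0`. -/
theorem isObservablePair_finite (hobs : S.RObservable) : IsObservablePair F.J (S.C * F.T₁) := by
  refine isObservablePair_of_eigenvectors fun z v hJ hC => ?_
  set F' := F.map (algebraMap ℝ ℂ)
  have h1 : matrixPencil S.E S.A z *ᵥ (F'.T₁ *ᵥ v) = 0 := by
    rw [Matrix.mulVec_mulVec, matrixPencil, F'.pencil_mul_T₁, ← Matrix.mulVec_mulVec,
      Matrix.sub_mulVec, Matrix.smul_mulVec, Matrix.one_mulVec]
    change F'.V₁ *ᵥ (z • v - F.J.map (algebraMap ℝ ℂ) *ᵥ v) = 0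
    rw [hJ, sub_self, Matrix.mulVec_zero]
  have h2 : S.C.map (algebraMap ℝ ℂ) *ᵥ (F'.T₁ *ᵥ v) = 0 := by
    rw [Matrix.mulVec_mulVec]
    rw [Matrix.map_mul] at hC
    exact hC
  have h3 : F'.T₁ *ᵥ v = 0 := by
    refine eq_zero_of_mulVec_eq_zero_of_rank (hobs z) ?_
    rw [fromRows_mulVec, h1, h2]
    ext i; cases i <;> rfl
  rw [← Matrix.one_mulVec v, ← F'.U₁_mul_T₁, ← Matrix.mulVec_mulVec, h3, Matrix.mulVec_zero]

theorem isControllablePair_finite (hctrl : S.RControllable) :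
    IsObservablePair F.Jᵀ (F.W₁ * S.B)ᵀ := by
  refine isObservablePair_of_eigenvectors fun z v hJ hB => ?_
  set F' := F.map (algebraMap ℝ ℂ)
  have h1 : (matrixPencil S.E S.A z)ᵀ *ᵥ (F'.W₁ᵀ *ᵥ v) = 0 := by
    rw [Matrix.mulVec_mulVec, ← Matrix.transpose_mul, matrixPencil, F'.W₁_mul_pencil,
      Matrix.transpose_mul, ← Matrix.mulVec_mulVec, Matrix.transpose_sub, Matrix.transpose_smul,
      Matrix.transpose_one, Matrix.sub_mulVec, Matrix.smul_mulVec, Matrix.one_mulVec]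
    change F'.U₁ᵀ *ᵥ (z • v - (F.Jᵀ).map (algebraMap ℝ ℂ) *ᵥ v) = 0
    rw [hJ, sub_self, Matrix.mulVec_zero]
  have h2 : (S.B.map (algebraMap ℝ ℂ))ᵀ *ᵥ (F'.W₁ᵀ *ᵥ v) = 0 := by
    rw [Matrix.mulVec_mulVec, ← Matrix.transpose_mul]
    rw [Matrix.transpose_map, Matrix.map_mul] at hB
    exact hB
  have h3 : F'.W₁ᵀ *ᵥ v = 0 := by
    have hr := hctrl z
    rw [← Matrix.rank_transpose, transpose_fromCols] at hr
    refine eq_zero_of_mulVec_eq_zero_of_rank hr ?_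
    rw [fromRows_mulVec, h1, h2]
    ext i; cases i <;> rfl
  rw [← Matrix.one_mulVec v, ← Matrix.transpose_one, ← F'.W₁_mul_V₁, Matrix.transpose_mul,
    ← Matrix.mulVec_mulVec, h3, Matrix.mulVec_zero]

theorem transfer_algebraMap {K : Type*} [Field K] [Algebra ℝ K] (s : ℝ) :
    S.transfer (algebraMap ℝ K s) = (S.transfer s).map (algebraMap ℝ K) := by
  have hinv : (matrixPencil S.E S.A (algebraMap ℝ K s))⁻¹
      = (matrixPencil S.E S.A s)⁻¹.map (algebraMap ℝ K) := by
    have h : matrixPencil S.E S.A (algebraMap ℝ K s)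
        = (matrixPencil S.E S.A s).map (algebraMap ℝ K) := by
      ext i j
      simp only [matrixPencil, Matrix.sub_apply, Matrix.smul_apply, Matrix.map_apply, smul_eq_mul,
        map_sub, map_mul, Algebra.algebraMap_self, RingHom.id_apply]
    rw [h, map_nonsing_inv_of_field]
  rw [transfer, hinv, transfer]
  simp [Matrix.map_add, Matrix.map_mul]

/-- All limit arguments run along the real axis; this restricts the complex identity to it. -/
theorem IsAllPass.transfer_real {S : DescriptorSystem n m m} {ς : ℝ} (h : S.IsAllPass ς) {s : ℝ}
    (h₁ : (s • S.E - S.A).det ≠ 0) (h₂ : ((-s) • S.E - S.A).det ≠ 0) :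
    S.transfer s * (S.transfer (-s))ᵀ = ς ^ 2 • (1 : Matrix (Fin m) (Fin m) ℝ) := by
  have hdet : ∀ t : ℝ, (t • S.E - S.A).det ≠ 0 →
      (matrixPencil S.E S.A (algebraMap ℝ ℂ t)).det ≠ 0 := by
    intro t ht
    have h : matrixPencil S.E S.A (algebraMap ℝ ℂ t)
        = (algebraMap ℝ ℂ).mapMatrix (t • S.E - S.A) := by
      ext i j; simp [matrixPencil]
    rw [h, ← RingHom.map_det]
    exact (_root_.map_ne_zero _).mpr ht
  have h3 := h (algebraMap ℝ ℂ s) (hdet s h₁) (by rw [← map_neg]; exact hdet (-s) h₂)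
  rw [← map_neg, transfer_algebraMap, transfer_algebraMap, ← Matrix.transpose_map,
    ← Matrix.map_mul] at h3
  apply Matrix.map_injective (algebraMap ℝ ℂ).injective
  refine h3.trans ?_
  ext i j
  rcases eq_or_ne i j with rfl | hij
  · simp
  · simp [hij]

end DescriptorSystem

/-! ### From all-pass to Gramians of the finite part, and back. -/

namespace DescriptorSystem

open Filter Topology

variable {n m nf ni : ℕ} {S : DescriptorSystem n m m}

/-- For large real `s`, neither `s` nor `-s` is an eigenvalue of `J`, so both transfer values are
given by the split formula. -/
theorem eventually_allPass_finite (F : DeflatingSplitting S.E S.A nf ni) {ς : ℝ}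
    (h : S.IsAllPass ς) {l : ℕ} (hl : F.N ^ (l + 1) = 0) :
    ∀ᶠ s : ℝ in atTop,
      (S.C * F.T₁ * (s • (1 : Matrix (Fin nf) (Fin nf) ℝ) - F.J)⁻¹ * (F.W₁ * S.B)
          + ∑ k ∈ Finset.range (l + 1), s ^ k • S.polynomialCoeff k)
        * (S.C * F.T₁ * ((-s) • (1 : Matrix (Fin nf) (Fin nf) ℝ) - F.J)⁻¹ * (F.W₁ * S.B)
          + ∑ k ∈ Finset.range (l + 1), (-s) ^ k • S.polynomialCoeff k)ᵀ
      = ς ^ 2 • (1 : Matrix (Fin m) (Fin m) ℝ) := by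
  filter_upwards [eventually_isUnit_resolvent F.J, eventually_isUnit_resolvent (-F.J)]
    with s h₁ h₂
  have h₂' : IsUnit ((-s) • (1 : Matrix (Fin nf) (Fin nf) ℝ) - F.J).det := by
    have : (-s) • (1 : Matrix (Fin nf) (Fin nf) ℝ) - F.J = -(s • 1 - -F.J) := by
      rw [neg_smul]; abel
    rw [← Matrix.isUnit_iff_isUnit_det] at h₂ ⊢
    rw [this]
    exact h₂.neg
  have htr : ∀ t : ℝ, IsUnit (t • (1 : Matrix (Fin nf) (Fin nf) ℝ) - F.J).det → S.transfer t
      = S.C * F.T₁ * (t • (1 : Matrix (Fin nf) (Fin nf) ℝ) - F.J)⁻¹ * (F.W₁ * S.B)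
          + ∑ k ∈ Finset.range (l + 1), t ^ k • S.polynomialCoeff k := by
    intro t ht
    have := S.transfer_eq F (z := t) hl l.succ_pos (by simpa using ht)
    simpa [S.polynomialCoeff_eq F] using this
  rw [← htr s h₁, ← htr (-s) h₂']
  exact h.transfer_real (F.isUnit_det_pencil h₁).ne_zero (F.isUnit_det_pencil h₂').ne_zero

theorem tendsto_neg_resolvent_part (F : DeflatingSplitting S.E S.A nf ni) :
    Tendsto (fun s : ℝ => S.C * F.T₁ * ((-s) • (1 : Matrix (Fin nf) (Fin nf) ℝ) - F.J)⁻¹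
      * (F.W₁ * S.B)) atTop (𝓝 0) := by
  have h := (tendsto_mul_resolvent_mul (-F.J) (F.W₁ * S.B) (S.C * F.T₁)).neg
  rw [neg_zero] at h
  refine h.congr fun s => ?_
  rw [neg_resolvent_neg, Matrix.mul_neg, Matrix.neg_mul]

theorem IsAllPass.polynomialCoeff_eq_zero (F : DeflatingSplitting S.E S.A nf ni) {ς : ℝ}
    (h : S.IsAllPass ς) {k : ℕ} (hk : 1 ≤ k) : S.polynomialCoeff k = 0 := by
  obtain ⟨l, hl⟩ := F.isNilpotent_N
  by_cases hkl : k < l + 1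
  · exact polynomial_coeff_eq_zero_of_allPass (tendsto_mul_resolvent_mul _ _ _)
      (tendsto_neg_resolvent_part F) _ _
      (eventually_allPass_finite F h (l := l) (by rw [pow_succ, hl, zero_mul])) hk hkl
  · have h1 : F.N ^ k = 0 := pow_eq_zero_of_le (by omega) hl
    simp [S.polynomialCoeff_eq F, infiniteCoeff, h1, show k ≠ 0 by omega]

theorem IsAllPass.eventually_proper (F : DeflatingSplitting S.E S.A nf ni) {ς : ℝ}
    (h : S.IsAllPass ς) :
    ∀ᶠ s : ℝ in atTop, (S.polynomialCoeff 0
        + S.C * F.T₁ * (s • (1 : Matrix (Fin nf) (Fin nf) ℝ) - F.J)⁻¹ * (F.W₁ * S.B))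
      * (S.polynomialCoeff 0
        + S.C * F.T₁ * ((-s) • (1 : Matrix (Fin nf) (Fin nf) ℝ) - F.J)⁻¹ * (F.W₁ * S.B))ᵀ
      = ς ^ 2 • (1 : Matrix (Fin m) (Fin m) ℝ) := by
  obtain ⟨l, hl⟩ := F.isNilpotent_N
  filter_upwards [eventually_allPass_finite F h (l := l) (by rw [pow_succ, hl, zero_mul])]
    with s hs
  have hsum : ∀ t : ℝ, ∑ k ∈ Finset.range (l + 1), t ^ k • S.polynomialCoeff k
      = S.polynomialCoeff 0 := fun t => by
    rw [Finset.sum_range_succ', Finset.sum_eq_zero, zero_add, pow_zero, one_smul]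
    intro k _
    rw [h.polynomialCoeff_eq_zero F (by omega), smul_zero]
  rw [hsum, hsum, add_comm, add_comm _ (S.polynomialCoeff 0)] at hs
  exact hs

/-- Let `s → ∞` in the proper all-pass identity; both resolvent terms vanish in the limit. -/
theorem IsAllPass.polynomialCoeff_zero_mul (F : DeflatingSplitting S.E S.A nf ni) {ς : ℝ}
    (h : S.IsAllPass ς) :
    S.polynomialCoeff 0 * (S.polynomialCoeff 0)ᵀ = ς ^ 2 • (1 : Matrix (Fin m) (Fin m) ℝ) := by
  have h1 := (tendsto_const_nhds (x := S.polynomialCoeff 0)).add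
    (tendsto_mul_resolvent_mul F.J (F.W₁ * S.B) (S.C * F.T₁))
  have h2 := (tendsto_const_nhds (x := S.polynomialCoeff 0)).add (tendsto_neg_resolvent_part F)
  rw [add_zero] at h1 h2
  have h3 := ((continuous_fst.matrix_mul continuous_snd.matrix_transpose).tendsto
    (S.polynomialCoeff 0, S.polynomialCoeff 0)).comp (h1.prodMk_nhds h2)
  exact tendsto_nhds_unique h3 (tendsto_const_nhds.congr' ((h.eventually_proper F).mono
    fun s hs => hs.symm))

/-- The Gramians of the finite part, transported to the original coordinates. -/
theorem gramians_of_finite (F : DeflatingSplitting S.E S.A nf ni) {ς : ℝ}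
    {D : Matrix (Fin m) (Fin m) ℝ} {X Y : Matrix (Fin nf) (Fin nf) ℝ} (hX : X.IsSymm)
    (hY : Y.IsSymm) (hXL : X * F.Jᵀ + F.J * X + (F.W₁ * S.B) * (F.W₁ * S.B)ᵀ = 0)
    (hYL : Y * F.J + F.Jᵀ * Y + (S.C * F.T₁)ᵀ * (S.C * F.T₁) = 0)
    (hXY : X * Y = ς ^ 2 • (1 : Matrix (Fin nf) (Fin nf) ℝ))
    (hYX : Y * X = ς ^ 2 • (1 : Matrix (Fin nf) (Fin nf) ℝ))
    (hBY : Dᵀ * (S.C * F.T₁) + (F.W₁ * S.B)ᵀ * Y = 0)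
    (hCX : D * (F.W₁ * S.B)ᵀ + (S.C * F.T₁) * X = 0) :
    ∃ Gpc Gpo : Matrix (Fin n) (Fin n) ℝ,
      (Gpc.IsSymm ∧ Gpo.IsSymm ∧ Gpc = (F.T₁ * F.U₁) * Gpc * (F.T₁ * F.U₁)ᵀ ∧
        Gpo = (F.V₁ * F.W₁)ᵀ * Gpo * (F.V₁ * F.W₁)) ∧
      (S.E * Gpc * S.Aᵀ + S.A * Gpc * S.Eᵀ
          + (F.V₁ * F.W₁) * S.B * S.Bᵀ * (F.V₁ * F.W₁)ᵀ = 0 ∧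
        S.Eᵀ * Gpo * S.A + S.Aᵀ * Gpo * S.E
          + (F.T₁ * F.U₁)ᵀ * S.Cᵀ * S.C * (F.T₁ * F.U₁) = 0) ∧
      (Gpc * S.Eᵀ * Gpo * S.E = ς ^ 2 • (F.T₁ * F.U₁) ∧
        Gpo * S.E * Gpc * S.Eᵀ = ς ^ 2 • (F.V₁ * F.W₁)ᵀ) ∧
      (Dᵀ * S.C * (F.T₁ * F.U₁) + S.Bᵀ * Gpo * S.E = 0 ∧
        D * S.Bᵀ * (F.V₁ * F.W₁)ᵀ + S.C * Gpc * S.Eᵀ = 0) := by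
  -- These are fixed by the projectors because `U₁ T₁ = 1` and `W₁ V₁ = 1`. Each remaining equation
  -- is the corresponding finite one, multiplied by suitable blocks among `T₁`, `U₁`, `V₁` and their
  -- transposes.
  refine ⟨F.T₁ * X * F.T₁ᵀ, F.W₁ᵀ * Y * F.W₁, ⟨?_, ?_, ?_, ?_⟩, ⟨?_, ?_⟩, ⟨?_, ?_⟩, ?_, ?_⟩
  · simp [Matrix.IsSymm, Matrix.transpose_mul, hX.eq, Matrix.mul_assoc]
  · simp [Matrix.IsSymm, Matrix.transpose_mul, hY.eq, Matrix.mul_assoc]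
  · calc F.T₁ * X * F.T₁ᵀ = F.T₁ * (F.U₁ * F.T₁) * X * (F.T₁ * (F.U₁ * F.T₁))ᵀ := by
          rw [F.U₁_mul_T₁, Matrix.mul_one]
      _ = _ := by simp only [Matrix.transpose_mul, Matrix.mul_assoc]
  · calc F.W₁ᵀ * Y * F.W₁ = ((F.W₁ * F.V₁) * F.W₁)ᵀ * Y * ((F.W₁ * F.V₁) * F.W₁) := by
          rw [F.W₁_mul_V₁, Matrix.one_mul]
      _ = _ := by simp only [Matrix.transpose_mul, Matrix.mul_assoc]
  · calc _ = (S.E * F.T₁) * X * (S.A * F.T₁)ᵀ + (S.A * F.T₁) * X * (S.E * F.T₁)ᵀ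
          + F.V₁ * ((F.W₁ * S.B) * (F.W₁ * S.B)ᵀ) * F.V₁ᵀ := by
          simp only [Matrix.transpose_mul, Matrix.mul_assoc]
      _ = F.V₁ * (X * F.Jᵀ + F.J * X + (F.W₁ * S.B) * (F.W₁ * S.B)ᵀ) * F.V₁ᵀ := by
          rw [F.E_mul_T₁, F.A_mul_T₁]
          simp only [Matrix.transpose_mul, Matrix.mul_assoc, Matrix.mul_add, Matrix.add_mul]
      _ = 0 := by rw [hXL, Matrix.mul_zero, Matrix.zero_mul]
  · calc _ = (F.W₁ * S.E)ᵀ * Y * (F.W₁ * S.A) + (F.W₁ * S.A)ᵀ * Y * (F.W₁ * S.E)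
          + F.U₁ᵀ * ((S.C * F.T₁)ᵀ * (S.C * F.T₁)) * F.U₁ := by
          simp only [Matrix.transpose_mul, Matrix.mul_assoc]
      _ = F.U₁ᵀ * (Y * F.J + F.Jᵀ * Y + (S.C * F.T₁)ᵀ * (S.C * F.T₁)) * F.U₁ := by
          rw [F.W₁_mul_E, F.W₁_mul_A]
          simp only [Matrix.transpose_mul, Matrix.mul_assoc, Matrix.mul_add, Matrix.add_mul]
      _ = 0 := by rw [hYL, Matrix.mul_zero, Matrix.zero_mul]
  · calc _ = F.T₁ * X * (F.W₁ * (S.E * F.T₁))ᵀ * Y * (F.W₁ * S.E) := by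
          simp only [Matrix.transpose_mul, Matrix.mul_assoc]
      _ = F.T₁ * (X * Y) * F.U₁ := by
          rw [F.E_mul_T₁, F.W₁_mul_V₁, F.W₁_mul_E, Matrix.transpose_one, Matrix.mul_one,
            Matrix.mul_assoc F.T₁]
      _ = _ := by rw [hXY, Matrix.mul_smul, Matrix.mul_one, Matrix.smul_mul]
  · calc _ = F.W₁ᵀ * Y * (F.W₁ * (S.E * F.T₁)) * X * (S.E * F.T₁)ᵀ := by
          simp only [Matrix.transpose_mul, Matrix.mul_assoc]
      _ = F.W₁ᵀ * (Y * X) * F.V₁ᵀ := by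
          rw [F.E_mul_T₁, F.W₁_mul_V₁, Matrix.mul_one, Matrix.mul_assoc F.W₁ᵀ]
      _ = _ := by
          rw [hYX, Matrix.mul_smul, Matrix.mul_one, Matrix.smul_mul, Matrix.transpose_mul]
  · calc _ = Dᵀ * (S.C * F.T₁) * F.U₁ + (F.W₁ * S.B)ᵀ * Y * (F.W₁ * S.E) := by
          simp only [Matrix.transpose_mul, Matrix.mul_assoc]
      _ = 0 := by rw [F.W₁_mul_E, ← Matrix.add_mul, hBY, Matrix.zero_mul]
  · calc _ = D * (F.W₁ * S.B)ᵀ * F.V₁ᵀ + S.C * F.T₁ * X * (S.E * F.T₁)ᵀ := by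
          simp only [Matrix.transpose_mul, Matrix.mul_assoc]
      _ = 0 := by rw [F.E_mul_T₁, ← Matrix.add_mul, hCX, Matrix.zero_mul]

/-- A controllability Gramian satisfying the coupling constraint makes a system with constant
polynomial part all-pass. -/
theorem isAllPass_of_gramian (F : DeflatingSplitting S.E S.A nf ni) {ς : ℝ}
    {G : Matrix (Fin n) (Fin n) ℝ} (hG : G.IsSymm)
    (hGP : G = (F.T₁ * F.U₁) * G * (F.T₁ * F.U₁)ᵀ)
    (hL : S.E * G * S.Aᵀ + S.A * G * S.Eᵀ
      + (F.V₁ * F.W₁) * S.B * S.Bᵀ * (F.V₁ * F.W₁)ᵀ = 0)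
    (hM₀ : S.polynomialCoeff 0 * (S.polynomialCoeff 0)ᵀ = ς ^ 2 • (1 : Matrix (Fin m) (Fin m) ℝ))
    (hM : ∀ k : ℕ, 1 ≤ k → S.polynomialCoeff k = 0)
    (hC : S.polynomialCoeff 0 * S.Bᵀ * (F.V₁ * F.W₁)ᵀ + S.C * G * S.Eᵀ = 0) :
    S.IsAllPass ς := by
  -- The projector condition gives `G = T₁ X T₁ᵀ`, so no information is lost. Multiplying by `W₁`
  -- and its transpose brings the equations back to finite coordinates.
  set X := F.U₁ * G * F.U₁ᵀ with hXdef
  have hGX : G = F.T₁ * X * F.T₁ᵀ := by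
    rw [hXdef]
    conv_lhs => rw [hGP]
    simp only [Matrix.transpose_mul, Matrix.mul_assoc]
  have hX : X.IsSymm := by
    simp [hXdef, Matrix.IsSymm, Matrix.transpose_mul, hG.eq, Matrix.mul_assoc]
  have hXL : X * F.Jᵀ + F.J * X + (F.W₁ * S.B) * (F.W₁ * S.B)ᵀ = 0 := by
    have h1 := congrArg (fun Q => F.W₁ * Q * F.W₁ᵀ) hL
    simp only [Matrix.mul_zero, Matrix.zero_mul] at h1
    rw [← h1]
    symm
    calc _ = (F.W₁ * S.E) * G * (F.W₁ * S.A)ᵀ + (F.W₁ * S.A) * G * (F.W₁ * S.E)ᵀ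
          + (F.W₁ * F.V₁) * ((F.W₁ * S.B) * (F.W₁ * S.B)ᵀ) * (F.W₁ * F.V₁)ᵀ := by
          simp only [Matrix.transpose_mul, Matrix.mul_assoc, Matrix.mul_add, Matrix.add_mul]
      _ = _ := by
          rw [F.W₁_mul_E, F.W₁_mul_A, F.W₁_mul_V₁, hXdef]
          simp only [Matrix.transpose_mul, Matrix.mul_assoc, Matrix.one_mul, Matrix.transpose_one,
            Matrix.mul_one]
  have hCX : S.polynomialCoeff 0 * (F.W₁ * S.B)ᵀ + (S.C * F.T₁) * X = 0 := by
    have h1 := congrArg (fun Q => Q * F.W₁ᵀ) hC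
    simp only [Matrix.zero_mul] at h1
    rw [← h1]
    symm
    calc _ = S.polynomialCoeff 0 * (F.W₁ * S.B)ᵀ * (F.W₁ * F.V₁)ᵀ
          + S.C * G * (F.W₁ * S.E)ᵀ := by
          simp only [Matrix.transpose_mul, Matrix.mul_assoc, Matrix.add_mul]
      _ = S.polynomialCoeff 0 * (F.W₁ * S.B)ᵀ + S.C * F.T₁ * X * (F.U₁ * F.T₁)ᵀ := by
          rw [F.W₁_mul_V₁, F.W₁_mul_E, Matrix.transpose_one, Matrix.mul_one, hGX]
          simp only [Matrix.transpose_mul, Matrix.mul_assoc]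
      _ = _ := by rw [F.U₁_mul_T₁, Matrix.transpose_one, Matrix.mul_one]
  obtain ⟨l, hl⟩ := F.isNilpotent_N
  have htr : ∀ z : ℂ, (matrixPencil S.E S.A z).det ≠ 0 →
      IsUnit (z • (1 : Matrix (Fin nf) (Fin nf) ℂ) - F.J.map (algebraMap ℝ ℂ)).det ∧
      S.transfer z = (S.polynomialCoeff 0).map (algebraMap ℝ ℂ)
        + (S.C * F.T₁).map (algebraMap ℝ ℂ)
          * (z • (1 : Matrix (Fin nf) (Fin nf) ℂ) - F.J.map (algebraMap ℝ ℂ))⁻¹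
          * (F.W₁ * S.B).map (algebraMap ℝ ℂ) := by
    intro z hz
    have hu := (F.map (algebraMap ℝ ℂ)).isUnit_det_finite (isUnit_iff_ne_zero.mpr hz)
    refine ⟨hu, ?_⟩
    rw [S.transfer_eq F (l := l + 1) (by rw [pow_succ, hl, zero_mul]) l.succ_pos hu,
      Finset.sum_range_succ', Finset.sum_eq_zero, zero_add, pow_zero, one_smul,
      S.polynomialCoeff_eq F, add_comm]
    intro k _
    rw [← S.polynomialCoeff_eq F, hM (k + 1) (by omega)]
    simp
  intro s h₁ h₂
  obtain ⟨hu₁, ht₁⟩ := htr s h₁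
  obtain ⟨hu₂, ht₂⟩ := htr (-s) h₂
  rw [ht₁, ht₂]
  refine allPass_of_gramian (X := X.map (algebraMap ℝ ℂ)) ?_ ?_ ?_ ?_ hu₁ hu₂
  · rw [Matrix.IsSymm, ← Matrix.transpose_map, hX.eq]
  · have := congrArg (fun Q => Q.map (algebraMap ℝ ℂ)) hXL
    simpa only [Matrix.map_add _ (map_add _), Matrix.map_mul, Matrix.transpose_map,
      Matrix.map_zero _ (map_zero _), Matrix.transpose_mul] using this
  · have := congrArg (fun Q => Q.map (algebraMap ℝ ℂ)) hM₀
    simp only [Matrix.map_mul, Matrix.transpose_map] at this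
    rw [this]
    ext i j
    rcases eq_or_ne i j with rfl | hij
    · simp
    · simp [hij]
  · have := congrArg (fun Q => Q.map (algebraMap ℝ ℂ)) hCX
    simpa only [Matrix.map_add _ (map_add _), Matrix.map_mul, Matrix.transpose_map,
      Matrix.map_zero _ (map_zero _), Matrix.transpose_mul] using this

end DescriptorSystem

/-! ### The characterization. -/

theorem theorem1 {n m : ℕ} (S : DescriptorSystem n m m) (hreg : S.IsRegular)
    (hctrl : S.RControllable) (hobs : S.RObservable) (ς : ℝ) (hς : 0 < ς) :
    S.IsAllPass ς ↔
      ∃ Gpc Gpo : Matrix (Fin n) (Fin n) ℝ,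
        -- symmetric matrices, compatible with the spectral projectors
        (Gpc.IsSymm ∧ Gpo.IsSymm ∧
          Gpc = S.rightProjector hreg * Gpc * (S.rightProjector hreg)ᵀ ∧
          Gpo = (S.leftProjector hreg)ᵀ * Gpo * S.leftProjector hreg) ∧
        -- projected generalized continuous-time Lyapunov equations
        (S.E * Gpc * S.Aᵀ + S.A * Gpc * S.Eᵀ
            + S.leftProjector hreg * S.B * S.Bᵀ * (S.leftProjector hreg)ᵀ = 0 ∧
          S.Eᵀ * Gpo * S.A + S.Aᵀ * Gpo * S.E
            + (S.rightProjector hreg)ᵀ * S.Cᵀ * S.C * S.rightProjector hreg = 0) ∧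
        -- proper Hankel singular values
        (Gpc * S.Eᵀ * Gpo * S.E = ς ^ 2 • S.rightProjector hreg ∧
          Gpo * S.E * Gpc * S.Eᵀ = ς ^ 2 • (S.leftProjector hreg)ᵀ) ∧
        -- polynomial part of the transfer function
        (S.polynomialCoeff 0 * (S.polynomialCoeff 0)ᵀ = ς ^ 2 • (1 : Matrix (Fin m) (Fin m) ℝ) ∧
          ∀ k : ℕ, 1 ≤ k → S.polynomialCoeff k = 0) ∧
        -- coupling constraints
        ((S.polynomialCoeff 0)ᵀ * S.C * S.rightProjector hreg + S.Bᵀ * Gpo * S.E = 0 ∧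
          S.polynomialCoeff 0 * S.Bᵀ * (S.leftProjector hreg)ᵀ + S.C * Gpc * S.Eᵀ = 0) := by
  -- The splitting must come from the very form chosen in the definition of the projectors, so that
  -- their factorizations apply directly.
  set F := (Classical.choice hreg.exists_weierstrassForm).splitting
  have hl : S.leftProjector hreg = F.V₁ * F.W₁ := WeierstrassForm.left_eq _
  have hr : S.rightProjector hreg = F.T₁ * F.U₁ := WeierstrassForm.right_eq _
  rw [hl, hr]
  constructor
  · intro h
    have hM₀ := h.polynomialCoeff_zero_mul F
    obtain ⟨X, Y, hX, hY, hXL, hYL, hXY, hYX, hBY, hCX⟩ := exists_gramians_of_allPass hς.ne'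
      (S.isControllablePair_finite F hctrl) (S.isObservablePair_finite F hobs) hM₀
      (h.eventually_proper F)
    obtain ⟨Gpc, Gpo, h1, h2, h3, h5⟩ :=
      DescriptorSystem.gramians_of_finite F hX hY hXL hYL hXY hYX hBY hCX
    exact ⟨Gpc, Gpo, h1, h2, h3, ⟨hM₀, fun k hk => h.polynomialCoeff_eq_zero F hk⟩, h5⟩
  · rintro ⟨Gpc, Gpo, ⟨hs, -, hP, -⟩, ⟨hL, -⟩, -, ⟨hM₀, hM⟩, -, hC⟩
    exact DescriptorSystem.isAllPass_of_gramian F hs hP hL hM₀ hM hC
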